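/- **Setting.** A self-join-free conjunctive query $q(\vec x)$ has subgoals $R_1(\vec x_1),\dots,R_m(\vec x_m)$ ($m\ge 1$, distinct relation symbols; arguments are variables or constants), variables $\mathrm{Var}(q)$, head variables $\mathrm{HVar}(q)$ and existential variables $\mathrm{EVar}(q)=\mathrm{Var}(q)\setminus\mathrm{HVar}(q)$. A *dissociation* of $q$ is $\Delta=(\vec y_1,\dots,\vec y_m)$ with $\vec y_i\subseteq \mathrm{Var}(q)\setminus \mathrm{Var}(R_i)$; $q^\Delta$ adds the variables $\vec y_i$ to subgoal $i$, and over a tuple-independent probabilistic database $D$ with active domain $A$ it is evaluated after replacing $R_i$ by $R_i\times A^{\vec y_i}$, all copies of a tuple being independent events with its probability. Dissociations are ordered by componentwise inclusion. $q^\Delta$ is *safe* if it is hierarchical (for any two existential variables, the sets of subgoals containing them are nested or disjoint). $r(\cdot)$ is the reliability (the probability, in a random possible world, of a given answer), and $\rho(q)=\min_\Delta r(q^\Delta)$ over safe dissociations $\Delta$ of $q$. A *plan* is built from atoms, projections and unordered $k$-ary joins ($k\ge2$), joins and projections alternating, each variable being projected away at most once. Its score is computed extensionally: joins multiply probabilities,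 projections combine them by $1-\prod(1-p)$. The dissociation $\Delta_P$ corresponding to a plan $P$ adds to every relation occurring in an operand $P_j$ of a join the existential variables that are head variables of another operand but not of $P_j$. **Schema knowledge.** Some relations are deterministic (all tuples have probability $1$), and a finite set $\Gamma$ of functional dependencies $\vec y\to\vec z$, each on the variables of one relation of $q$, holds. A database *conforms* if it satisfies both. **Algorithm DP** (on a query). (i) If there is one subgoal, return the projection of it onto the head. (ii) If $q$ is disconnected, where subgoals are connected by shared existential variables, return all joins of one plan from $\mathrm{DP}(q_c)$ for each component $q_c$, with $\mathrm{HVar}(q_c)=\mathrm{HVar}(q)\cap\mathrm{Var}(q_c)$. (iii) Otherwise let $\vec z$ be the set of separator variables, i.e. existential variables that occur in all probabilistic subgoals. If $\vec z\neq\emptyset$ and adding $\vec z$ to the head disconnects $q$, put $\mathcal Y=\{\vec z\}$. If $\vec z\ne\emptyset$ does not disconnect $q$, let $\mathcal Y$ be the set of all $\vec z\cup\vec y$ with $\vec y$ a top set (an inclusion-minimal set of existential variables whose addition to the head disconnects the query) of $q$ with head $\mathrm{HVar}(q)\cup\vec z$. If $\vec z=\emptyset$, let $\mathcal Y$ be the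 set of top sets of $q$. Return, for all $\vec w\in\mathcal Y$, the plans that project $\vec w$ away from a plan returned by DP for $q$ with head $\mathrm{HVar}(q)\cup\vec w$. **Algorithm FP.** For all dependencies $\vec y\to\vec z$ in $\Gamma$ and all relations $R_i$, visited in any order: if the current variables of $R_i$ include $\vec y$, dissociate $R_i$ on the variables of $\vec z$ it does not contain. Let $\tilde q$ be the resulting query; return $\mathrm{DP}(\tilde q)$. **Theorem.** FP is a sound and complete enumeration of minimal query plans in the presence of functional dependencies and deterministic relations, in the following sense. 1. Every returned $P$ is a plan for $\tilde q$, $\Delta_P$ is a safe dissociation of $\tilde q$, and $\mathrm{score}(P)=r(\tilde q^{\Delta_P})$ on every database, for every answer. 2. (Soundness) No returned plan is dominated by another one: if $P,P'$ are returned and $\Delta_{P'}\le\Delta_P$, then $P'=P$. Moreover, no safe dissociation of $\tilde q$ strictly dominates a returned plan: if $\Delta$ is a safe dissociation of $\tilde q$ with $\Delta\le\Delta_P$, then $\Delta$ and $\Delta_P$ agree on all probabilistic relations, and $r(\tilde q^{\Delta})=\mathrm{score}(P)$ on every conforming database, for every answer. 3. (Completeness) For every safe dissociation $\Delta$ of the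 original query $q$ there is a returned plan $P$ with $\mathrm{score}(P)\le r(q^\Delta)$ on all conforming databases, for all answers. In particular, on every conforming database and for every answer, the minimum defining $\rho(q)$ is attained and the minimum score of the returned plans equals $\rho(q)$. -/

import Mathlib

open scoped Classical

/-! ## Self-join-free conjunctive queries and dissociations -/

/-- A self-join-free conjunctive query.  The relation symbols are the elements of `ι` and every
relation symbol is used by exactly one subgoal, so `ι` also indexes the subgoals.  `V` is the type
of variables, `U` the type of constants; the `k`-th argument of subgoal `i` is a variable or a
constant. -/
structure CQ (ι V U : Type*) [Fintype ι] where
  arity : ι → ℕ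
  args : (i : ι) → Fin (arity i) → V ⊕ U
  /-- the head (free) variables -/
  head : Finset V
  head_subset : ∀ x ∈ head, ∃ i k, args i k = Sum.inl x

namespace CQ

variable {ι V U : Type*} [Fintype ι]

/-- The variables `Var(gᵢ)` of subgoal `i`. -/
noncomputable def atomVars (q : CQ ι V U) (i : ι) : Finset V :=
  Finset.univ.biUnion fun k => Sum.elim (fun x => {x}) (fun _ => ∅) (q.args i k)

/-- The variables `Var(q)` of the query. -/
noncomputable def vars (q : CQ ι V U) : Finset V :=
  Finset.univ.biUnion q.atomVars

/-- The tuple of constants obtained from subgoal `i` under a valuation of the variables. -/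
def ground (q : CQ ι V U) (θ : V → U) (i : ι) : Fin (q.arity i) → U :=
  fun k => Sum.elim θ id (q.args i k)

/-- The variables of subgoal `i` of the dissociated query `q^Δ`: those of subgoal `i` of `q`,
followed by the added variables `Δ i`. -/
noncomputable def dissVars (q : CQ ι V U) (Δ : ι → Finset V) (i : ι) : Finset V :=
  q.atomVars i ∪ Δ i

/-- `Δ` is a dissociation of the (possibly already dissociated) query `q^Δ₀`: it adds to each
subgoal variables of the query that the subgoal does not yet contain.  The result of this further
dissociation is `q^(Δ₀ ⊔ Δ)`.  Dissociations of `q` itself are the case `Δ₀ = ⊥`. -/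
def IsDissociation (q : CQ ι V U) (Δ₀ Δ : ι → Finset V) : Prop :=
  ∀ i, Δ i ⊆ q.vars \ q.dissVars Δ₀ i

/-- `q^Δ` is safe, that is, hierarchical: the sets of subgoals containing two existential
variables are nested or disjoint. -/
def IsSafe (q : CQ ι V U) (Δ : ι → Finset V) : Prop :=
  ∀ x ∈ q.vars \ q.head, ∀ y ∈ q.vars \ q.head,
    {i | x ∈ q.dissVars Δ i} ⊆ {i | y ∈ q.dissVars Δ i} ∨
    {i | y ∈ q.dissVars Δ i} ⊆ {i | x ∈ q.dissVars Δ i} ∨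
    Disjoint {i | x ∈ q.dissVars Δ i} {i | y ∈ q.dissVars Δ i}

end CQ

/-! ## Tuple-independent probabilistic databases and reliability -/

/-- A tuple-independent probabilistic database: finitely many tuples in each relation, each with
its probability. -/
structure PDB {ι : Type*} (arity : ι → ℕ) (U : Type*) where
  tuples : (i : ι) → Finset (Fin (arity i) → U)
  prob : (i : ι) → (Fin (arity i) → U) → ℝ
  prob_nonneg : ∀ i, ∀ t ∈ tuples i, 0 ≤ prob i t
  prob_le_one : ∀ i, ∀ t ∈ tuples i, prob i t ≤ 1

/-- The active domain: all constants that occur in the database. -/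
noncomputable def PDB.activeDomain {ι U : Type*} [Fintype ι] {arity : ι → ℕ} (D : PDB arity U) :
    Finset U :=
  Finset.univ.biUnion fun i => (D.tuples i).biUnion fun t => Finset.univ.image t

namespace CQ

variable {ι V U : Type*} [Fintype ι]

/-- Tuples of the dissociated schema: a relation symbol `i`, a tuple of relation `i`, and values
for the variables in `Δ i`. -/
abbrev DissTuple (q : CQ ι V U) (Δ : ι → Finset V) : Type _ :=
  (i : ι) × (Fin (q.arity i) → U) × ({x // x ∈ Δ i} → U)

/-- The tuples of the dissociated database: each table `Rᵢ` is replaced by its product with one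
copy of the active domain for each variable in `Δ i`. -/
noncomputable def dissTuples (q : CQ ι V U) (Δ : ι → Finset V) (D : PDB q.arity U) :
    Finset (q.DissTuple Δ) :=
  Finset.univ.sigma fun i => D.tuples i ×ˢ Fintype.piFinset fun _ => D.activeDomain

/-- `a|head` is an answer of `q^Δ` in the possible world `W`. -/
def HoldsIn (q : CQ ι V U) (Δ : ι → Finset V) (W : Finset (q.DissTuple Δ)) (a : V → U) : Prop :=
  ∃ θ : V → U, (∀ x ∈ q.head, θ x = a x) ∧ ∀ i, ⟨i, q.ground θ i, fun x => θ x⟩ ∈ W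

/-- The reliability `r(q^Δ)` of the answer given by the values of `a` on the head variables: the
probability that it is an answer of the dissociated query in a random world of the dissociated
database.  Copies of a tuple have its probability and are independent.  `Δ = ⊥` gives `r(q)`. -/
noncomputable def reliability (q : CQ ι V U) (Δ : ι → Finset V) (D : PDB q.arity U) (a : V → U) :
    ℝ :=
  ∑ W ∈ (q.dissTuples Δ D).powerset with q.HoldsIn Δ W a,
    (∏ e ∈ W, D.prob e.1 e.2.1) * ∏ e ∈ q.dissTuples Δ D \ W, (1 - D.prob e.1 e.2.1)

/-- The reliabilities of all safe dissociations of `q`. -/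
def safeReliabilities (q : CQ ι V U) (D : PDB q.arity U) (a : V → U) : Set ℝ :=
  {r | ∃ Δ, q.IsDissociation ⊥ Δ ∧ q.IsSafe Δ ∧ r = q.reliability Δ D a}

/-- The propagation score `ρ(q)`: the minimum reliability over all safe dissociations. -/
noncomputable def propagationScore (q : CQ ι V U) (D : PDB q.arity U) (a : V → U) : ℝ :=
  sInf (q.safeReliabilities D a)

end CQ

/-! ## Query plans -/

/-- Query plans.  The operands of a join are labelled by their sets of relation symbols; as no
relation symbol is repeated, this makes joins unordered. -/
inductive Plan (ι V : Type*) where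
  | atom (i : ι) : Plan ι V
  /-- `proj X P` projects (with duplicate elimination) onto `X` -/
  | proj (X : Finset V) (P : Plan ι V) : Plan ι V
  | join (κ : Finset (Finset ι)) (P : {c // c ∈ κ} → Plan ι V) : Plan ι V

namespace Plan

variable {ι V : Type*}

/-- The relation symbols that occur in a plan. -/
noncomputable def atoms : Plan ι V → Finset ι
  | atom i => {i}
  | proj _ P => P.atoms
  | join _ P => Finset.univ.biUnion fun c => (P c).atoms

/-- The head variables of a plan, where `vars i` are the variables of relation `i`. -/
noncomputable def headVars (vars : ι → Finset V) : Plan ι V → Finset V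
  | atom i => vars i
  | proj X _ => X
  | join _ P => Finset.univ.biUnion fun c => (P c).headVars vars

/-- The project-away operator: project the variables `Y` away. -/
noncomputable def projAway (vars : ι → Finset V) (Y : Finset V) (P : Plan ι V) : Plan ι V :=
  proj (P.headVars vars \ Y) P

def IsProj : Plan ι V → Prop
  | proj _ _ => True
  | _ => False

def IsJoin : Plan ι V → Prop
  | join _ _ => True
  | _ => False

/-- Shape of a plan: joins have at least two operands, over disjoint sets of relations and labelled
by these sets; joins and projections alternate; a projection keeps only head variables. -/
def WellFormed (vars : ι → Finset V) : Plan ι V → Prop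
  | atom _ => True
  | proj X P => X ⊆ P.headVars vars ∧ ¬ P.IsProj ∧ P.WellFormed vars
  | join κ P => 2 ≤ κ.card ∧ (∀ c ∈ κ, ∀ d ∈ κ, c ≠ d → Disjoint c d) ∧
      ∀ c, (P c).atoms = c ∧ ¬ (P c).IsJoin ∧ (P c).WellFormed vars

/-- The number of projections of the plan that project `x` away. -/
noncomputable def projCount (vars : ι → Finset V) (x : V) : Plan ι V → ℕ
  | atom _ => 0
  | proj X P => P.projCount vars x + if x ∈ P.headVars vars \ X then 1 else 0
  | join _ P => ∑ c, (P c).projCount vars x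

/-- `P` is a plan for the query with subgoals `ι`, variables `vars i` in subgoal `i`, and head
variables `H`. -/
def IsPlanFor [Fintype ι] (vars : ι → Finset V) (H : Finset V) (P : Plan ι V) : Prop :=
  P.atoms = Finset.univ ∧ P.headVars vars = H ∧ P.WellFormed vars ∧ ∀ x, P.projCount vars x ≤ 1

/-- The dissociation that corresponds to a plan: for each join and each operand `P c` of it, every
relation of `P c` is dissociated on those existential variables (those outside `H`) among the join
variables that are missing from the head of `P c`. -/
noncomputable def dissociation (vars : ι → Finset V) (H : Finset V) :
    Plan ι V → ι → Finset V
  | atom _ => fun _ => ∅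
  | proj _ P => P.dissociation vars H
  | join κ P => fun i => Finset.univ.biUnion fun c : {c // c ∈ κ} =>
      if i ∈ (P c).atoms then
        (((join κ P).headVars vars \ (P c).headVars vars) \ H) ∪ (P c).dissociation vars H i
      else ∅

/-- The extensional score of the tuple `θ|headVars P` in the intermediate relation computed by the
plan `P` for `q^Δ` over the dissociated database; it is `0` for tuples that are not in this
relation.  Joins multiply; a projection combines the tuples with the same projection as independent
events (tuples outside of the relation contribute the factor `1`). -/
noncomputable def score {U : Type*} [Fintype ι] (q : CQ ι V U) (Δ : ι → Finset V)
    (D : PDB q.arity U) : Plan ι V → (V → U) → ℝ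
  | atom i, θ =>
      if q.ground θ i ∈ D.tuples i ∧ ∀ x ∈ Δ i, θ x ∈ D.activeDomain
      then D.prob i (q.ground θ i) else 0
  | proj X P, θ =>
      1 - ∏ b ∈ Fintype.piFinset
            (fun _ : {x // x ∈ P.headVars (q.dissVars Δ) \ X} => D.activeDomain),
          (1 - P.score q Δ D fun x =>
            if h : x ∈ P.headVars (q.dissVars Δ) \ X then b ⟨x, h⟩ else θ x)
  | join _ P, θ => ∏ c, (P c).score q Δ D θ

end Plan

/-! ## The enumeration algorithm with deterministic relations

Throughout, `vars i` are the variables of relation `i`; a (sub)query is given by its set `S` of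
subgoals and its set `H` of head variables. -/

namespace PlanEnum

variable {ι V : Type*}

/-- `Var(q)` of the subquery with subgoals `S`. -/
noncomputable def varsOf (vars : ι → Finset V) (S : Finset ι) : Finset V := S.biUnion vars

/-- Two subgoals share an existential variable. -/
def Linked (vars : ι → Finset V) (S : Finset ι) (H : Finset V) (i j : ι) : Prop :=
  i ∈ S ∧ j ∈ S ∧ ∃ x, x ∈ vars i ∧ x ∈ vars j ∧ x ∉ H

/-- All subgoals are connected through existential variables. -/
def Connected (vars : ι → Finset V) (S : Finset ι) (H : Finset V) : Prop :=
  ∀ i ∈ S, ∀ j ∈ S, Relation.ReflTransGen (Linked vars S H) i j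

/-- The component of subgoal `i`. -/
noncomputable def component (vars : ι → Finset V) (S : Finset ι) (H : Finset V) (i : ι) :
    Finset ι :=
  S.filter fun j => Relation.ReflTransGen (Linked vars S H) i j

/-- The components of the query. -/
noncomputable def components (vars : ι → Finset V) (S : Finset ι) (H : Finset V) :
    Finset (Finset ι) :=
  S.image (component vars S H)

/-- `TopSet(q)`: the minimal sets of existential variables whose removal (that is, whose addition
to the head) disconnects the query. -/
noncomputable def topSets (vars : ι → Finset V) (S : Finset ι) (H : Finset V) :
    Finset (Finset V) :=
  (varsOf vars S \ H).powerset.filter fun Y =>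
    ¬ Connected vars S (H ∪ Y) ∧ ∀ Z, Z ⊂ Y → Connected vars S (H ∪ Z)

/-- `SepVar(q)`: the existential variables that occur in all probabilistic subgoals. -/
noncomputable def sepVars (vars : ι → Finset V) (det : Finset ι) (S : Finset ι) (H : Finset V) :
    Finset V :=
  (varsOf vars S \ H).filter fun x => ∀ i ∈ S, i ∉ det → x ∈ vars i

lemma measure_component {vars : ι → Finset V} {S : Finset ι} {H : Finset V}
    (h : ¬ Connected vars S H) {c : Finset ι} (hc : c ∈ components vars S H) :
    c.card + (varsOf vars c \ (H ∩ varsOf vars c)).card < S.card + (varsOf vars S \ H).card := by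
  obtain ⟨k, hk, rfl⟩ := Finset.mem_image.1 hc
  have hsub : component vars S H k ⊆ S := Finset.filter_subset _ _
  have hss : component vars S H k ⊂ S := by
    refine hsub.ssubset_of_ne fun he => h fun i hi j hj => ?_
    have hi' : Relation.ReflTransGen (Linked vars S H) k i := by
      rw [← he] at hi; exact (Finset.mem_filter.1 hi).2
    have hj' : Relation.ReflTransGen (Linked vars S H) k j := by
      rw [← he] at hj; exact (Finset.mem_filter.1 hj).2
    have hsymm : Std.Symm (Linked vars S H) :=
      ⟨fun a b ⟨ha, hb, x, hx, hy, hz⟩ => ⟨hb, ha, x, hy, hx, hz⟩⟩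
    exact (Std.Symm.symm (r := Relation.ReflTransGen (Linked vars S H)) _ _ hi').trans hj'
  have h2 : varsOf vars (component vars S H k) \ (H ∩ varsOf vars (component vars S H k)) ⊆
      varsOf vars S \ H := by
    intro x hx
    simp only [Finset.mem_sdiff, Finset.mem_inter, not_and] at hx ⊢
    exact ⟨Finset.biUnion_subset_biUnion_of_subset_left _ hsub hx.1, fun hH => hx.2 hH hx.1⟩
  have := Finset.card_lt_card hss
  have := Finset.card_le_card h2
  omega

lemma measure_head {W H Y Z : Finset V} {n : ℕ} (hY : Y.Nonempty) (hYW : Y ⊆ W \ H)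
    (hHZ : H ∪ Y ⊆ Z) : n + (W \ Z).card < n + (W \ H).card := by
  refine Nat.add_lt_add_left (Finset.card_lt_card ?_) n
  obtain ⟨y, hy⟩ := hY
  refine (Finset.ssubset_iff_of_subset ?_).2 ⟨y, hYW hy, ?_⟩
  · exact Finset.sdiff_subset_sdiff subset_rfl (Finset.subset_union_left.trans hHZ)
  · simp [hHZ (Finset.mem_union_right _ hy)]

lemma topSets_nonempty {vars : ι → Finset V} {S : Finset ι} {H Y : Finset V}
    (h : Connected vars S H) (hY : Y ∈ topSets vars S H) : Y.Nonempty := by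
  rw [Finset.nonempty_iff_ne_empty]
  rintro rfl
  exact (Finset.mem_filter.1 hY).2.1 (by simpa using h)

/-- The recursive algorithm `DP` for a query with deterministic relations `det`. -/
noncomputable def DP (vars : ι → Finset V) (det : Finset ι) (S : Finset ι) (H : Finset V) :
    Finset (Plan ι V) :=
  if S.card ≤ 1 then
    S.image fun i => Plan.proj H (Plan.atom i)
  else if hc : ¬ Connected vars S H then
    -- one operand for each component, in all combinations
    (Fintype.piFinset fun c : {c // c ∈ components vars S H} =>
        DP vars det c.1 (H ∩ varsOf vars c.1)).image
      fun P => Plan.join (components vars S H) P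
  else if hz : (sepVars vars det S H).Nonempty then
    if hc' : ¬ Connected vars S (H ∪ sepVars vars det S H) then
      (DP vars det S (H ∪ sepVars vars det S H)).image
        (Plan.projAway vars (sepVars vars det S H))
    else
      (topSets vars S (H ∪ sepVars vars det S H)).biUnion fun Y =>
        (DP vars det S (H ∪ sepVars vars det S H ∪ Y)).image
          (Plan.projAway vars (sepVars vars det S H ∪ Y))
  else
    (topSets vars S H).attach.biUnion fun Y =>
      (DP vars det S (H ∪ Y.1)).image (Plan.projAway vars Y.1)
termination_by S.card + (varsOf vars S \ H).card
decreasing_by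
  · exact measure_component hc c.2
  · exact measure_head hz (Finset.filter_subset _ _) subset_rfl
  · exact measure_head hz (Finset.filter_subset _ _) Finset.subset_union_left
  · exact measure_head (topSets_nonempty (not_not.1 hc) Y.2)
      (Finset.mem_powerset.1 (Finset.mem_filter.1 Y.2).1) subset_rfl

end PlanEnum

/-! ## Functional dependencies and the algorithm `FP` -/

/-- A functional dependency `lhs → rhs` on relation `rel`, written with the variables of the
query. -/
structure FD (ι V : Type*) where
  rel : ι
  lhs : Finset V
  rhs : Finset V

namespace CQ

variable {ι V U : Type*} [Fintype ι]

/-- The functional dependency is one on (the variables of) its relation. -/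
def ValidFD (q : CQ ι V U) (Γ : FD ι V) : Prop :=
  Γ.lhs ∪ Γ.rhs ⊆ q.atomVars Γ.rel

/-- The database conforms to the schema knowledge: tuples of deterministic relations have
probability `1`, and the functional dependencies hold. -/
def Conforms (q : CQ ι V U) (det : Finset ι) (Γs : Set (FD ι V)) (D : PDB q.arity U) : Prop :=
  (∀ i ∈ det, ∀ t ∈ D.tuples i, D.prob i t = 1) ∧
  ∀ Γ ∈ Γs, ∀ θ θ' : V → U,
    q.ground θ Γ.rel ∈ D.tuples Γ.rel → q.ground θ' Γ.rel ∈ D.tuples Γ.rel →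
    (∀ x ∈ Γ.lhs, θ x = θ' x) → ∀ y ∈ Γ.rhs, θ y = θ' y

/-- One iteration of the first loop of `FP`: if the left-hand side of the dependency is contained in
the variables of relation `i` (including those on which it has already been dissociated), then
dissociate relation `i` on the dependent variables it does not contain. -/
noncomputable def fdStep (q : CQ ι V U) (Δ : ι → Finset V) (p : FD ι V × ι) : ι → Finset V :=
  if p.1.lhs ⊆ q.dissVars Δ p.2 then
    Function.update Δ p.2 (Δ p.2 ∪ (p.1.rhs \ q.atomVars p.2))
  else Δ

/-- The first loop of `FP`, visiting the pairs of a dependency and a relation in the order `L`. -/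
noncomputable def fdDissociation (q : CQ ι V U) (L : List (FD ι V × ι)) : ι → Finset V :=
  L.foldl q.fdStep ⊥

/-- The algorithm `FP`: apply the eager dissociation, then call `DP` on the resulting query. -/
noncomputable def FP (q : CQ ι V U) (det : Finset ι) (L : List (FD ι V × ι)) :
    Finset (Plan ι V) :=
  PlanEnum.DP (q.dissVars (q.fdDissociation L)) det Finset.univ q.head

end CQ

/-! The proof joins the combinatorics of hierarchical queries, the probability of copied tuples, and
closure under dependencies.

Combinatorics. All branches of step (iii) of `DP` project away a minimal set that contains the
separator variables and disconnects the query (`cuts`, `cuts_eq_image`). Hence the outputs of `DP`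
form an inductive predicate `Enumerated`, and their properties follow by rule induction. In a
connected hierarchical query with at least two subgoals, the variables that occur in all subgoals
disconnect it (`SafeOn.not_connected`). Given a safe dissociation, adding the separator variables to
the deterministic subgoals keeps it safe; the variables that then occur everywhere contain a cut,
and recursion yields an enumerated plan below the dissociation on the probabilistic relations
(`exists_enumerated`). Conversely, the cut of a plan can be read off its dissociation as the set of
current existential variables that reach all subgoals (`cut_subset_dissociation`, `subset_cut`), so
minimality of cuts excludes domination (`dissociation_subset_of_safe`, `eq_of_dissociation_le`).

Probability. Variables projected away occur in every subgoal of the dissociated subquery, and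
operands of a join use different relations, so both operators combine independent events and the
score is a reliability (`score_eq_worldProb`). Replacing tuples by independent copies, one tuple at
a time, can only raise the probability of a query without self-joins (`worldProb_le_copies`,
`reliability_mono`). It changes nothing if the tuple is certain or the event sees at most one of its
copies (`worldProb_eq_copies`, `reliability_eq_of_determined`).

Dependencies. Adding a dependent variable wherever the left-hand side occurs preserves safety
(`safeOn_addDependent`), and it preserves reliability because the value is determined. So every safe
dissociation extends at no cost to a safe one closed under the dependencies
(`exists_safeOn_closed`). The extension contains whatever the loop of `FP` adds, in any order, and
therefore lies above an enumerated plan on the probabilistic relations; on the deterministic ones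
extra variables are free. -/

namespace PlanEnum

variable {ι V : Type*} {vars : ι → Finset V} {det S : Finset ι} {H : Finset V}

/-! ### Connectivity and components -/

lemma mem_varsOf {x : V} : x ∈ varsOf vars S ↔ ∃ i ∈ S, x ∈ vars i := by
  simp [varsOf]

lemma varsOf_mono {S' : Finset ι} (h : S ⊆ S') : varsOf vars S ⊆ varsOf vars S' :=
  Finset.biUnion_subset_biUnion_of_subset_left _ h

lemma Linked.symm {i j : ι} (h : Linked vars S H i j) : Linked vars S H j i :=
  let ⟨hi, hj, x, hx, hy, hz⟩ := h
  ⟨hj, hi, x, hy, hx, hz⟩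

lemma reach_symm {i j : ι} (h : Relation.ReflTransGen (Linked vars S H) i j) :
    Relation.ReflTransGen (Linked vars S H) j i := by
  induction h with
  | refl => exact .refl
  | tail _ hl ih => exact .head hl.symm ih

lemma connected_of_card_le_one (h : S.card ≤ 1) : Connected vars S H := fun i hi j hj => by
  rw [Finset.card_le_one.1 h i hi j hj]

lemma mem_component {i j : ι} :
    j ∈ component vars S H i ↔ j ∈ S ∧ Relation.ReflTransGen (Linked vars S H) i j := by
  simp [component]

lemma subset_of_mem_components {c : Finset ι} (hc : c ∈ components vars S H) : c ⊆ S := by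
  obtain ⟨k, -, rfl⟩ := Finset.mem_image.1 hc
  exact Finset.filter_subset _ _

lemma nonempty_of_mem_components {c : Finset ι} (hc : c ∈ components vars S H) : c.Nonempty := by
  obtain ⟨k, hk, rfl⟩ := Finset.mem_image.1 hc
  exact ⟨k, mem_component.2 ⟨hk, .refl⟩⟩

lemma exists_mem_components {i : ι} (hi : i ∈ S) : ∃ c ∈ components vars S H, i ∈ c :=
  ⟨_, Finset.mem_image_of_mem _ hi, mem_component.2 ⟨hi, .refl⟩⟩

lemma component_eq {i j : ι} (h : Relation.ReflTransGen (Linked vars S H) i j) :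
    component vars S H i = component vars S H j := by
  ext l
  rw [mem_component, mem_component]
  exact and_congr_right fun _ => ⟨(reach_symm h).trans, h.trans⟩

lemma eq_component {c : Finset ι} (hc : c ∈ components vars S H) {i : ι} (hi : i ∈ c) :
    c = component vars S H i := by
  obtain ⟨k, -, rfl⟩ := Finset.mem_image.1 hc
  exact component_eq (mem_component.1 hi).2

lemma components_eq_of_mem {c d : Finset ι} (hc : c ∈ components vars S H)
    (hd : d ∈ components vars S H) {i : ι} (hic : i ∈ c) (hid : i ∈ d) : c = d :=
  (eq_component hc hic).trans (eq_component hd hid).symm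

lemma disjoint_components {c d : Finset ι} (hc : c ∈ components vars S H)
    (hd : d ∈ components vars S H) (h : c ≠ d) : Disjoint c d :=
  Finset.disjoint_left.2 fun _ hic hid => h (components_eq_of_mem hc hd hic hid)

/-- An existential variable occurs in one component only. -/
lemma components_eq_of_mem_varsOf {c d : Finset ι} (hc : c ∈ components vars S H)
    (hd : d ∈ components vars S H) {x : V} (hxc : x ∈ varsOf vars c) (hxd : x ∈ varsOf vars d)
    (hxH : x ∉ H) : c = d := by
  obtain ⟨i, hi, hxi⟩ := mem_varsOf.1 hxc
  obtain ⟨j, hj, hxj⟩ := mem_varsOf.1 hxd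
  rw [eq_component hc hi, eq_component hd hj]
  exact component_eq (.single ⟨subset_of_mem_components hc hi, subset_of_mem_components hd hj, x,
    hxi, hxj, hxH⟩)

/-- A walk that starts in a component never leaves it, and its linking variables are not in `H`, so
it is also a walk of the subquery. -/
lemma connected_of_mem_components {c : Finset ι} (hc : c ∈ components vars S H) :
    Connected vars c (H ∩ varsOf vars c) := by
  have key : ∀ i ∈ c, ∀ j, Relation.ReflTransGen (Linked vars S H) i j →
      Relation.ReflTransGen (Linked vars c (H ∩ varsOf vars c)) i j := by
    intro i hi j h
    have hmem : ∀ j, Relation.ReflTransGen (Linked vars S H) i j → j ∈ S → j ∈ c := by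
      intro j h hj
      rw [eq_component hc hi]
      exact mem_component.2 ⟨hj, h⟩
    induction h with
    | refl => exact .refl
    | tail h hl ih =>
      refine ih.tail ?_
      obtain ⟨ha, hb, x, hx, hy, hz⟩ := hl
      exact ⟨hmem _ h ha, hmem _ (h.tail ⟨ha, hb, x, hx, hy, hz⟩) hb, x, hx, hy,
        fun hx' => hz (Finset.mem_inter.1 hx').1⟩
  intro i hi j hj
  refine key i hi j ?_
  rw [eq_component hc hi] at hj
  exact (mem_component.1 hj).2

lemma two_le_card_components (h : ¬ Connected vars S H) : 2 ≤ (components vars S H).card := by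
  simp only [Connected, not_forall] at h
  obtain ⟨i, hi, j, hj, hij⟩ := h
  refine Finset.one_lt_card.2 ⟨_, Finset.mem_image_of_mem _ hi, _, Finset.mem_image_of_mem _ hj,
    fun he => hij ?_⟩
  have : j ∈ component vars S H i := he ▸ mem_component.2 ⟨hj, .refl⟩
  exact (mem_component.1 this).2

lemma biUnion_components : (components vars S H).biUnion id = S := by
  ext i
  simp only [Finset.mem_biUnion, id]
  exact ⟨fun ⟨c, hc, hi⟩ => subset_of_mem_components hc hi, exists_mem_components⟩

/-! ### The sets of variables that `DP` projects away -/

/-- The minimal sets of existential variables that contain all separator variables and whose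
addition to the head disconnects the query. -/
noncomputable def cuts (vars : ι → Finset V) (det S : Finset ι) (H : Finset V) :
    Finset (Finset V) :=
  (varsOf vars S \ H).powerset.filter fun Y =>
    sepVars vars det S H ⊆ Y ∧ ¬ Connected vars S (H ∪ Y) ∧
      ∀ Z, sepVars vars det S H ⊆ Z → Z ⊂ Y → Connected vars S (H ∪ Z)

lemma mem_cuts {Y : Finset V} : Y ∈ cuts vars det S H ↔ Y ⊆ varsOf vars S \ H ∧
    sepVars vars det S H ⊆ Y ∧ ¬ Connected vars S (H ∪ Y) ∧
      ∀ Z, sepVars vars det S H ⊆ Z → Z ⊂ Y → Connected vars S (H ∪ Z) := by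
  simp [cuts]

lemma mem_topSets {Y : Finset V} : Y ∈ topSets vars S H ↔ Y ⊆ varsOf vars S \ H ∧
    ¬ Connected vars S (H ∪ Y) ∧ ∀ Z, Z ⊂ Y → Connected vars S (H ∪ Z) := by
  simp [topSets]

lemma sepVars_subset : sepVars vars det S H ⊆ varsOf vars S \ H := Finset.filter_subset _ _

lemma cuts_nonempty (h : Connected vars S H) {Y : Finset V} (hY : Y ∈ cuts vars det S H) :
    Y.Nonempty := by
  rw [Finset.nonempty_iff_ne_empty]
  rintro rfl
  exact (mem_cuts.1 hY).2.2.1 (by simpa using h)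

lemma exists_cut_subset {X : Finset V} (hX : X ⊆ varsOf vars S \ H)
    (hz : sepVars vars det S H ⊆ X) (hc : ¬ Connected vars S (H ∪ X)) :
    ∃ Y ∈ cuts vars det S H, Y ⊆ X := by
  induction X using Finset.strongInduction with
  | H X ih =>
    by_cases h : ∀ Z, sepVars vars det S H ⊆ Z → Z ⊂ X → Connected vars S (H ∪ Z)
    · exact ⟨X, mem_cuts.2 ⟨hX, hz, hc, h⟩, subset_rfl⟩
    · push Not at h
      obtain ⟨Z, hzZ, hZX, hZ⟩ := h
      obtain ⟨Y, hY, hYZ⟩ := ih Z hZX (hZX.subset.trans hX) hzZ hZ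
      exact ⟨Y, hY, hYZ.trans hZX.subset⟩

lemma cuts_of_not_connected (h : ¬ Connected vars S (H ∪ sepVars vars det S H)) :
    cuts vars det S H = {sepVars vars det S H} := by
  ext Y
  rw [mem_cuts, Finset.mem_singleton]
  constructor
  · rintro ⟨-, hz, -, hm⟩
    by_contra hne
    exact h (hm _ subset_rfl (hz.ssubset_of_ne fun he => hne he.symm))
  · rintro rfl
    exact ⟨sepVars_subset, subset_rfl, h, fun Z h1 h2 => absurd h1 h2.2⟩

/-- Unifies the branches of step (iii). Once the separators are in the head, minimality among the
sets containing them becomes plain minimality of the remaining variables. -/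
lemma cuts_eq_image : cuts vars det S H =
    if Connected vars S (H ∪ sepVars vars det S H) then
      (topSets vars S (H ∪ sepVars vars det S H)).image (sepVars vars det S H ∪ ·)
    else {sepVars vars det S H} := by
  split_ifs with h
  swap
  · exact cuts_of_not_connected h
  set z := sepVars vars det S H with hz
  have hzs : z ⊆ varsOf vars S \ H := sepVars_subset
  ext Y
  rw [mem_cuts, Finset.mem_image, ← hz]
  constructor
  · rintro ⟨hY, hzY, hc, hm⟩
    refine ⟨Y \ z, mem_topSets.2 ⟨?_, ?_, ?_⟩, Finset.union_sdiff_of_subset hzY⟩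
    · intro x hx
      have := hY (Finset.mem_sdiff.1 hx).1
      simp only [Finset.mem_sdiff, Finset.mem_union] at *
      tauto
    · rwa [Finset.union_assoc, Finset.union_sdiff_of_subset hzY]
    · intro Z hZ
      rw [Finset.union_assoc]
      refine hm _ Finset.subset_union_left ?_
      refine (Finset.ssubset_iff_of_subset ?_).2 ?_
      · exact Finset.union_subset hzY (hZ.subset.trans Finset.sdiff_subset)
      · obtain ⟨x, hx, hxZ⟩ := Finset.exists_of_ssubset hZ
        exact ⟨x, (Finset.mem_sdiff.1 hx).1, by simp [hxZ, (Finset.mem_sdiff.1 hx).2]⟩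
  · rintro ⟨y, hy, rfl⟩
    obtain ⟨h1, h2, h3⟩ := mem_topSets.1 hy
    refine ⟨?_, Finset.subset_union_left, by rwa [← Finset.union_assoc], ?_⟩
    · refine Finset.union_subset hzs (h1.trans ?_)
      exact Finset.sdiff_subset_sdiff subset_rfl Finset.subset_union_left
    · intro Z hzZ hZ
      have := h3 (Z \ z) ?_
      · rwa [Finset.union_assoc, Finset.union_sdiff_of_subset hzZ] at this
      · obtain ⟨x, hx, hxZ⟩ := Finset.exists_of_ssubset hZ
        refine (Finset.ssubset_iff_of_subset ?_).2 ⟨x, ?_, ?_⟩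
        · intro x hx
          have := hZ.subset (Finset.mem_sdiff.1 hx).1
          simp only [Finset.mem_sdiff, Finset.mem_union] at *
          tauto
        · have := fun hh => hxZ (hzZ hh)
          simp only [Finset.mem_union] at hx
          tauto
        · simp [hxZ]

/-! ### `DP` as an inductive predicate -/

lemma DP_of_card_le_one (h : S.card ≤ 1) :
    DP vars det S H = S.image fun i => Plan.proj H (Plan.atom i) := by
  rw [DP, if_pos h]

lemma DP_of_not_connected (h : ¬ Connected vars S H) :
    DP vars det S H = (Fintype.piFinset fun c : {c // c ∈ components vars S H} =>
        DP vars det c.1 (H ∩ varsOf vars c.1)).image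
      fun P => Plan.join (components vars S H) P := by
  rw [DP, if_neg fun h' => h (connected_of_card_le_one h'), dif_pos h]

lemma DP_of_connected (h1 : ¬ S.card ≤ 1) (h : Connected vars S H) :
    DP vars det S H = (cuts vars det S H).biUnion fun w =>
      (DP vars det S (H ∪ w)).image (Plan.projAway vars w) := by
  rw [DP, if_neg h1, dif_neg (not_not.2 h), cuts_eq_image]
  by_cases hz : (sepVars vars det S H).Nonempty
  · by_cases h2 : Connected vars S (H ∪ sepVars vars det S H)
    · simp [hz, h2, Finset.image_biUnion, Finset.union_assoc]
    · simp [hz, h2]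
  -- Without separators the cuts are the top sets of the query itself.
  · rw [Finset.not_nonempty_iff_eq_empty] at hz
    ext P
    simp [hz, h]

/-- The plans returned by `DP` for the query with subgoals `S` and head variables `H`. -/
inductive Enumerated (vars : ι → Finset V) (det : Finset ι) :
    Finset ι → Finset V → Plan ι V → Prop
  | single (i : ι) (H : Finset V) (hH : H ⊆ vars i) :
      Enumerated vars det {i} H (Plan.proj H (Plan.atom i))
  | join (S : Finset ι) (H : Finset V) (hH : H ⊆ varsOf vars S) (hc : ¬ Connected vars S H)
      (P : {c // c ∈ components vars S H} → Plan ι V)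
      (hP : ∀ c, Enumerated vars det c.1 (H ∩ varsOf vars c.1) (P c)) :
      Enumerated vars det S H (Plan.join (components vars S H) P)
  | proj (S : Finset ι) (H w : Finset V) (hH : H ⊆ varsOf vars S) (h1 : ¬ S.card ≤ 1)
      (hc : Connected vars S H) (hw : w ∈ cuts vars det S H) (P : Plan ι V)
      (hP : Enumerated vars det S (H ∪ w) P) :
      Enumerated vars det S H (Plan.proj H P)

lemma biUnion_inter_varsOf (hH : H ⊆ varsOf vars S) :
    (Finset.univ.biUnion fun c : {c // c ∈ components vars S H} => H ∩ varsOf vars c.1) = H := by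
  ext x
  simp only [Finset.mem_biUnion, Finset.mem_univ, true_and, Finset.mem_inter, Subtype.exists]
  constructor
  · rintro ⟨c, hc, hx, -⟩
    exact hx
  · intro hx
    obtain ⟨i, hi, hxi⟩ := mem_varsOf.1 (hH hx)
    obtain ⟨c, hc, hic⟩ := exists_mem_components (vars := vars) (H := H) hi
    exact ⟨c, hc, hx, mem_varsOf.2 ⟨i, hic, hxi⟩⟩

namespace Enumerated

variable {P : Plan ι V}

lemma head_subset (h : Enumerated vars det S H P) : H ⊆ varsOf vars S := by
  cases h with
  | single i _ hH => simpa [varsOf] using hH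
  | join _ _ hH => exact hH
  | proj _ _ _ hH => exact hH

lemma headVars_eq (h : Enumerated vars det S H P) : P.headVars vars = H := by
  induction h with
  | single i H hH => rfl
  | join S H hH hc P hP ih =>
    simp only [Plan.headVars, ih]
    exact biUnion_inter_varsOf hH
  | proj => rfl

lemma atoms_eq (h : Enumerated vars det S H P) : P.atoms = S := by
  induction h with
  | single i H hH => rfl
  | join S H hH hc P hP ih =>
    simp only [Plan.atoms, ih]
    conv_rhs => rw [← biUnion_components (vars := vars) (S := S) (H := H)]
    ext i
    simp
  | proj S H w hH h1 hc hw P hP ih => exact ih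

/-- A cut is disjoint from `H`, so the `proj` constructor can record the remaining head instead of
the projected variables. -/
lemma eq_projAway {w : Finset V} (hw : w ∈ cuts vars det S H)
    (h : Enumerated vars det S (H ∪ w) P) : Plan.projAway vars w P = Plan.proj H P := by
  rw [Plan.projAway, h.headVars_eq, Finset.union_sdiff_cancel_right]
  rw [Finset.disjoint_right]
  exact fun x hx => (Finset.mem_sdiff.1 ((mem_cuts.1 hw).1 hx)).2

lemma mem_DP (h : Enumerated vars det S H P) : P ∈ DP vars det S H := by
  induction h with
  | single i H hH => simp [DP_of_card_le_one]
  | join S H hH hc P hP ih =>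
    rw [DP_of_not_connected hc]
    exact Finset.mem_image_of_mem _ (Fintype.mem_piFinset.2 ih)
  | proj S H w hH h1 hc hw P hP ih =>
    rw [DP_of_connected h1 hc, Finset.mem_biUnion]
    exact ⟨w, hw, Finset.mem_image.2 ⟨P, ih, eq_projAway hw hP⟩⟩

end Enumerated

lemma union_subset_of_mem_cuts {w : Finset V} (hw : w ∈ cuts vars det S H)
    (hH : H ⊆ varsOf vars S) : H ∪ w ⊆ varsOf vars S :=
  Finset.union_subset hH ((mem_cuts.1 hw).1.trans Finset.sdiff_subset)

/-- Induction along the recursive calls of `DP`. -/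
lemma DP_induction {motive : Finset ι → Finset V → Prop}
    (single : ∀ i H, H ⊆ vars i → motive {i} H)
    (join : ∀ S H, H ⊆ varsOf vars S → ¬ Connected vars S H →
      (∀ c ∈ components vars S H, motive c (H ∩ varsOf vars c)) → motive S H)
    (proj : ∀ S H, H ⊆ varsOf vars S → ¬ S.card ≤ 1 → Connected vars S H →
      (∀ w ∈ cuts vars det S H, motive S (H ∪ w)) → motive S H)
    (hS : S.Nonempty) (hH : H ⊆ varsOf vars S) : motive S H := by
  induction hn : S.card + (varsOf vars S \ H).card using Nat.strong_induction_on
    generalizing S H with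
  | _ n ih =>
    subst hn
    by_cases h1 : S.card ≤ 1
    · obtain ⟨i, rfl⟩ := Finset.card_eq_one.1 (le_antisymm h1 hS.card_pos)
      exact single i H (by simpa [varsOf] using hH)
    by_cases hc : Connected vars S H
    · refine proj S H hH h1 hc fun w hw => ?_
      exact ih _ (measure_head (cuts_nonempty hc hw) (mem_cuts.1 hw).1 subset_rfl) hS
        (union_subset_of_mem_cuts hw hH) rfl
    · refine join S H hH hc fun c hcc => ?_
      exact ih _ (measure_component hc hcc) (nonempty_of_mem_components hcc)
        Finset.inter_subset_right rfl

lemma mem_DP_iff (hS : S.Nonempty) (hH : H ⊆ varsOf vars S) {P : Plan ι V} :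
    P ∈ DP vars det S H ↔ Enumerated vars det S H P := by
  refine ⟨?_, Enumerated.mem_DP⟩
  revert P
  refine DP_induction (vars := vars) (det := det)
    (motive := fun S H => ∀ {P}, P ∈ DP vars det S H → Enumerated vars det S H P)
    ?_ ?_ ?_ hS hH
  · intro i H hH P hP
    rw [DP_of_card_le_one (by simp)] at hP
    obtain rfl : P = Plan.proj H (Plan.atom i) := by simpa using hP
    exact .single i H hH
  · intro S H hH hc ih P hP
    rw [DP_of_not_connected hc] at hP
    obtain ⟨Q, hQ, rfl⟩ := Finset.mem_image.1 hP
    exact .join S H hH hc Q fun c => ih c.1 c.2 (Fintype.mem_piFinset.1 hQ c)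
  · intro S H hH h1 hc ih P hP
    rw [DP_of_connected h1 hc] at hP
    obtain ⟨w, hw, hP⟩ := Finset.mem_biUnion.1 hP
    obtain ⟨Q, hQ, rfl⟩ := Finset.mem_image.1 hP
    rw [Enumerated.eq_projAway hw (ih w hw hQ)]
    exact .proj S H w hH h1 hc hw Q (ih w hw hQ)

end PlanEnum

namespace PlanEnum

variable {ι V : Type*} {vars : ι → Finset V} {det S : Finset ι} {H H₀ : Finset V}

namespace Enumerated

variable {P : Plan ι V}

/-! ### Enumerated plans are plans -/

lemma isProj_of_connected (h : Enumerated vars det S H P) (hc : Connected vars S H) :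
    P.IsProj := by
  cases h with
  | single => trivial
  | join _ _ _ hc' => exact absurd hc hc'
  | proj => trivial

lemma not_isProj_of_not_connected (h : Enumerated vars det S H P) (hc : ¬ Connected vars S H) :
    ¬ P.IsProj := by
  cases h with
  | single => exact absurd (connected_of_card_le_one (by simp)) hc
  | join => exact id
  | proj _ _ _ _ _ hc' => exact absurd hc' hc

/-- Joins and projections alternate because components are connected, which forces a projection on
top, while a query with a cut in its head is disconnected, which forces a join. -/
lemma wellFormed (h : Enumerated vars det S H P) : P.WellFormed vars := by
  induction h with
  | single i H hH => exact ⟨hH, id, trivial⟩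
  | join S H hH hc P hP ih =>
    refine ⟨two_le_card_components hc, fun c hc d hd => disjoint_components hc hd, fun c =>
      ⟨(hP c).atoms_eq, fun hj => ?_, ih c⟩⟩
    have := (hP c).isProj_of_connected (connected_of_mem_components c.2)
    cases hPc : P c <;> rw [hPc] at this hj
    exacts [this, hj, this]
  | proj S H w hH h1 hc hw P hP ih =>
    exact ⟨by rw [hP.headVars_eq]; exact Finset.subset_union_left,
      hP.not_isProj_of_not_connected (mem_cuts.1 hw).2.2.1, ih⟩

/-- The sharper bound makes the induction work: at a join an existential variable belongs to one
component only, and at a projection the variables of `w` are head variables of the operand, hence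
not projected again below. -/
lemma projCount_le (h : Enumerated vars det S H P) (x : V) :
    P.projCount vars x ≤ if x ∈ varsOf vars S \ H then 1 else 0 := by
  induction h with
  | single i H hH => simp [Plan.projCount, Plan.headVars, varsOf]
  | join S H hH hc P hP ih =>
    rw [Plan.projCount]
    refine (Finset.sum_le_sum fun c _ => ih c).trans ?_
    rw [Finset.sum_ite, Finset.sum_const_zero, add_zero, Finset.sum_const, smul_eq_mul, mul_one]
    split_ifs with hx
    · refine Finset.card_le_one.2 fun c hcx d hdx => ?_
      simp only [Finset.mem_filter, Finset.mem_univ, true_and, Finset.mem_sdiff] at hcx hdx hx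
      exact Subtype.ext (components_eq_of_mem_varsOf c.2 d.2 hcx.1 hdx.1 hx.2)
    · rw [Nat.le_zero, Finset.card_eq_zero, Finset.filter_eq_empty_iff]
      intro c _ hcx
      simp only [Finset.mem_sdiff, Finset.mem_inter, not_and, not_not] at hcx hx
      exact hcx.2 (hx (varsOf_mono (subset_of_mem_components c.2) hcx.1)) hcx.1
  | proj S H w hH h1 hc hw P hP ih =>
    have hw' := (mem_cuts.1 hw).1
    rw [Plan.projCount, hP.headVars_eq]
    by_cases hx : x ∈ w
    · have := Finset.mem_sdiff.1 (hw' hx)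
      simp only [Finset.mem_sdiff, Finset.mem_union, hx, this.1, this.2] at ih ⊢
      simpa using ih
    · by_cases hxH : x ∈ H <;>
        simpa [Finset.mem_sdiff, Finset.mem_union, hx, hxH] using ih

/-! ### The dissociation of an enumerated plan -/

lemma dissociation_join {κ : Finset (Finset ι)} (P : {c // c ∈ κ} → Plan ι V)
    (hd : ∀ c ∈ κ, ∀ d ∈ κ, c ≠ d → Disjoint c d) (hP : ∀ c, (P c).atoms = c.1)
    (c : {c // c ∈ κ}) {i : ι} (hi : i ∈ c.1) :
    (Plan.join κ P).dissociation vars H₀ i =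
      (((Plan.join κ P).headVars vars \ (P c).headVars vars) \ H₀) ∪
        (P c).dissociation vars H₀ i := by
  rw [Plan.dissociation]
  ext x
  simp only [Finset.mem_biUnion, Finset.mem_univ, true_and, hP]
  constructor
  · rintro ⟨d, hx⟩
    split_ifs at hx with hid
    · have : d = c := by
        by_contra hne
        exact Finset.disjoint_left.1 (hd _ d.2 _ c.2 fun he => hne (Subtype.ext he)) hid hi
      exact this ▸ hx
    · exact absurd hx (Finset.notMem_empty _)
  · intro hx
    exact ⟨c, by rwa [if_pos hi]⟩

lemma dissociation_components (hH : H ⊆ varsOf vars S)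
    {P : {c // c ∈ components vars S H} → Plan ι V}
    (hP : ∀ c, Enumerated vars det c.1 (H ∩ varsOf vars c.1) (P c))
    (c : {c // c ∈ components vars S H}) {i : ι} (hi : i ∈ c.1) :
    (Plan.join _ P).dissociation vars H₀ i =
      ((H \ varsOf vars c.1) \ H₀) ∪ (P c).dissociation vars H₀ i := by
  rw [dissociation_join P (fun c hc d hd => disjoint_components hc hd)
    (fun c => (hP c).atoms_eq) c hi, (hP c).headVars_eq]
  congr 2
  have : (Plan.join _ P).headVars vars = H := by
    simp only [Plan.headVars, fun c => (hP c).headVars_eq]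
    exact biUnion_inter_varsOf hH
  rw [this]
  ext x
  simp

lemma dissociation_subset (h : Enumerated vars det S H P) {i : ι} (hi : i ∈ S) :
    P.dissociation vars H₀ i ⊆ varsOf vars S \ vars i := by
  induction h with
  | single i H hH => exact Finset.empty_subset _
  | join S H hH hc P hP ih =>
    obtain ⟨c, hcc, hic⟩ := exists_mem_components (vars := vars) (H := H) hi
    rw [dissociation_components hH hP ⟨c, hcc⟩ hic]
    refine Finset.union_subset ?_ ((ih ⟨c, hcc⟩ hic).trans ?_)
    · intro x hx
      simp only [Finset.mem_sdiff] at hx ⊢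
      exact ⟨hH hx.1.1, fun hxi => hx.1.2 (mem_varsOf.2 ⟨i, hic, hxi⟩)⟩
    · exact Finset.sdiff_subset_sdiff (varsOf_mono (subset_of_mem_components hcc)) subset_rfl
  | proj S H w hH h1 hc hw P hP ih => exact ih hi

lemma dissociation_disjoint (h : Enumerated vars det S H P) {i : ι} (hi : i ∈ S) :
    Disjoint (P.dissociation vars H₀ i) H₀ := by
  induction h with
  | single i H hH => exact Finset.disjoint_empty_left _
  | join S H hH hc P hP ih =>
    obtain ⟨c, hcc, hic⟩ := exists_mem_components (vars := vars) (H := H) hi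
    rw [dissociation_components hH hP ⟨c, hcc⟩ hic]
    exact Finset.disjoint_union_left.2 ⟨Finset.sdiff_disjoint, ih ⟨c, hcc⟩ hic⟩
  | proj S H w hH h1 hc hw P hP ih => exact ih hi

/-- `H₀` is the head of the whole query and `H` the head of the current subplan. What joins do not
find in an operand they add to all its relations, so head variables reach every relation. -/
lemma head_subset_dissociation (h : Enumerated vars det S H P) {i : ι} (hi : i ∈ S) :
    H \ H₀ ⊆ vars i ∪ P.dissociation vars H₀ i := by
  induction h with
  | single j H hH =>
    obtain rfl := Finset.mem_singleton.1 hi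
    exact (Finset.sdiff_subset.trans hH).trans Finset.subset_union_left
  | join S H hH hc P hP ih =>
    obtain ⟨c, hcc, hic⟩ := exists_mem_components (vars := vars) (H := H) hi
    rw [dissociation_components hH hP ⟨c, hcc⟩ hic]
    intro x hx
    have := @ih ⟨c, hcc⟩ hic x
    simp only [Finset.mem_sdiff, Finset.mem_union, Finset.mem_inter] at this hx ⊢
    tauto
  | proj S H w hH h1 hc hw P hP ih =>
    exact (Finset.sdiff_subset_sdiff Finset.subset_union_left subset_rfl).trans (ih hi)

/-- This is what makes projections independent and dissociations of plans hierarchical. -/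
lemma cut_subset_dissociation (h₀ : varsOf vars S ∩ H₀ ⊆ H) {w : Finset V}
    (hw : w ∈ cuts vars det S H) (h : Enumerated vars det S (H ∪ w) P) {i : ι} (hi : i ∈ S) :
    w ⊆ vars i ∪ P.dissociation vars H₀ i := by
  refine subset_trans (fun x hx => ?_) (h.head_subset_dissociation hi)
  have := Finset.mem_sdiff.1 ((mem_cuts.1 hw).1 hx)
  refine Finset.mem_sdiff.2 ⟨Finset.mem_union_right _ hx, fun hx' => this.2 (h₀ ?_)⟩
  exact Finset.mem_inter.2 ⟨this.1, hx'⟩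

/-- After adding a cut to the head, the dissociated plan has no further variable that occurs
in all subgoals. -/
lemma subset_cut {w : Finset V} (hw : w ∈ cuts vars det S H)
    (h : Enumerated vars det S (H ∪ w) P) {X : Finset V} (hXH : Disjoint X H)
    (hX : ∀ i ∈ S, X ⊆ vars i ∪ P.dissociation vars H₀ i) : X ⊆ w := by
  have hc := (mem_cuts.1 hw).2.2.1
  generalize hH' : H ∪ w = H' at h hc
  cases h with
  | single i _ _ => exact absurd (connected_of_card_le_one (by simp)) hc
  | proj _ _ _ _ _ hc' => exact absurd hc' hc
  | join _ _ hH _ P hP =>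
    subst hH'
    intro x hx
    by_contra hxw
    have hxH : x ∉ H ∪ w := by
      simpa [hxw] using Finset.disjoint_left.1 hXH hx
    -- A variable outside the new head that reaches all subgoals would occur in every component, but
    -- there are at least two and it belongs to one.
    have key : ∀ c ∈ components vars S (H ∪ w), x ∈ varsOf vars c := by
      intro c hcc
      obtain ⟨i, hi⟩ := nonempty_of_mem_components hcc
      have hxi := hX i (subset_of_mem_components hcc hi) hx
      rw [dissociation_components hH hP ⟨c, hcc⟩ hi] at hxi
      rcases Finset.mem_union.1 hxi with hxi | hxi
      · exact mem_varsOf.2 ⟨i, hi, hxi⟩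
      rcases Finset.mem_union.1 hxi with hxi | hxi
      · exact absurd (Finset.mem_sdiff.1 (Finset.mem_sdiff.1 hxi).1).1 hxH
      · exact (Finset.mem_sdiff.1 ((hP ⟨c, hcc⟩).dissociation_subset hi hxi)).1
    obtain ⟨c, hcc, d, hd, hne⟩ := Finset.one_lt_card.1 (two_le_card_components hc)
    exact hne (components_eq_of_mem_varsOf hcc hd (key c hcc) (key d hd) hxH)

end Enumerated

/-! ### Safety -/

/-- The query with subgoals `S`, variables `E i` in subgoal `i`, and existential variables
`varsOf vars S \ H` is hierarchical. -/
def SafeOn (vars : ι → Finset V) (S : Finset ι) (H : Finset V) (E : ι → Finset V) : Prop :=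
  ∀ x ∈ varsOf vars S \ H, ∀ y ∈ varsOf vars S \ H,
    (∀ i ∈ S, x ∈ E i → y ∈ E i) ∨ (∀ i ∈ S, y ∈ E i → x ∈ E i) ∨
      ∀ i ∈ S, x ∈ E i → y ∉ E i

lemma SafeOn.mono {E : ι → Finset V} (h : SafeOn vars S H E) {vars' : ι → Finset V}
    {S' : Finset ι} {H' : Finset V} (hS : S' ⊆ S)
    (hH : varsOf vars' S' \ H' ⊆ varsOf vars S \ H) : SafeOn vars' S' H' E := by
  intro x hx y hy
  exact (h x (hH hx) y (hH hy)).imp (fun h i hi => h i (hS hi))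
    (Or.imp (fun h i hi => h i (hS hi)) fun h i hi => h i (hS hi))

lemma component_sdiff_subset {c : Finset ι} (hc : c ∈ components vars S H) :
    varsOf vars c \ (H ∩ varsOf vars c) ⊆ varsOf vars S \ H := by
  intro x hx
  simp only [Finset.mem_sdiff, Finset.mem_inter, not_and] at hx ⊢
  exact ⟨varsOf_mono (subset_of_mem_components hc) hx.1, fun h => hx.2 h hx.1⟩

lemma SafeOn.component {E : ι → Finset V} (h : SafeOn vars S H E) {c : Finset ι}
    (hc : c ∈ components vars S H) : SafeOn vars c (H ∩ varsOf vars c) E :=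
  h.mono (subset_of_mem_components hc) (component_sdiff_subset hc)

/-- In a connected safe query with at least two subgoals, adding the variables that occur in all
subgoals to the head disconnects the query. -/
lemma SafeOn.not_connected {E : ι → Finset V} (h : SafeOn vars S H E) (h1 : ¬ S.card ≤ 1)
    (hE : ∀ i ∈ S, vars i ⊆ E i) :
    ¬ Connected vars S (H ∪ (varsOf vars S \ H).filter fun x => ∀ i ∈ S, x ∈ E i) := by
  set X := (varsOf vars S \ H).filter fun x => ∀ i ∈ S, x ∈ E i with hX
  intro hc
  have hne : (varsOf vars S \ (H ∪ X)).Nonempty := by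
    obtain ⟨i, hi, j, hj, hij⟩ := Finset.one_lt_card.1 (not_le.1 h1)
    rcases Relation.ReflTransGen.cases_head (hc i hi j hj) with he | ⟨k, ⟨-, -, x, hx, -, hxH⟩, -⟩
    · exact absurd he hij
    · exact ⟨x, Finset.mem_sdiff.2 ⟨mem_varsOf.2 ⟨i, hi, hx⟩, hxH⟩⟩
  -- Among the remaining existential variables, none of which is everywhere, `x` lies in the most
  -- subgoals. Connectedness gives a link by some `y` from a subgoal with `x` to one without, and
  -- each way for `x` and `y` to be hierarchical then fails.
  obtain ⟨x, hx, hmax⟩ := Finset.exists_max_image _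
    (fun x => (S.filter fun i => x ∈ E i).card) hne
  have hex : ∀ y ∈ varsOf vars S \ (H ∪ X), y ∈ varsOf vars S \ H := fun y hy => by
    simp only [Finset.mem_sdiff, Finset.mem_union, not_or] at hy ⊢
    exact ⟨hy.1, hy.2.1⟩
  have hxX : ∃ j ∈ S, x ∉ E j := by
    by_contra! hall
    exact (Finset.mem_sdiff.1 hx).2
      (Finset.mem_union_right _ (Finset.mem_filter.2 ⟨hex x hx, hall⟩))
  obtain ⟨j, hj, hxj⟩ := hxX
  obtain ⟨i, hi, hxi⟩ := mem_varsOf.1 (Finset.mem_sdiff.1 hx).1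
  have hedge : ∀ k, Relation.ReflTransGen (Linked vars S (H ∪ X)) i k → k ∈ S → x ∉ E k →
      ∃ a b, x ∈ E a ∧ x ∉ E b ∧ Linked vars S (H ∪ X) a b := by
    intro k hk
    induction hk with
    | refl => exact fun _ h => absurd (hE i hi hxi) h
    | @tail b c hb hbc ih =>
      intro _ hxc
      by_cases hxb : x ∈ E b
      · exact ⟨b, c, hxb, hxc, hbc⟩
      · exact ih hbc.1 hxb
  obtain ⟨a, b, hxa, hxb, ha, hb, y, hya, hyb, hyH⟩ := hedge j (hc i hi j hj) hj hxj
  have hy : y ∈ varsOf vars S \ (H ∪ X) :=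
    Finset.mem_sdiff.2 ⟨mem_varsOf.2 ⟨a, ha, hya⟩, hyH⟩
  rcases h x (hex x hx) y (hex y hy) with h | h | h
  · refine (hmax y hy).not_gt (Finset.card_lt_card ?_)
    refine (Finset.ssubset_iff_of_subset ?_).2 ⟨b, ?_, ?_⟩
    · intro k hk
      rw [Finset.mem_filter] at hk ⊢
      exact ⟨hk.1, h k hk.1 hk.2⟩
    · exact Finset.mem_filter.2 ⟨hb, hE b hb hyb⟩
    · exact fun hh => hxb (Finset.mem_filter.1 hh).2
  · exact hxb (h b hb (hE b hb hyb))
  · exact h a ha hxa (hE a ha hya)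

/-- Adding the separator variables to the deterministic subgoals. -/
noncomputable def addSep (vars : ι → Finset V) (det S : Finset ι) (H : Finset V)
    (E : ι → Finset V) : ι → Finset V :=
  fun i => if i ∈ det then E i ∪ sepVars vars det S H else E i

lemma addSep_of_notMem {E : ι → Finset V} {i : ι} (hi : i ∉ det) :
    addSep vars det S H E i = E i := if_neg hi

lemma subset_addSep {E : ι → Finset V} (i : ι) : E i ⊆ addSep vars det S H E i := by
  unfold addSep
  split_ifs
  exacts [Finset.subset_union_left, subset_rfl]

lemma sepVars_subset_addSep {E : ι → Finset V} (hE : ∀ i ∈ S, vars i ⊆ E i) {i : ι} (hi : i ∈ S) :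
    sepVars vars det S H ⊆ addSep vars det S H E i := by
  unfold addSep
  split_ifs with h
  · exact Finset.subset_union_right
  · exact fun x hx => hE i hi ((Finset.mem_filter.1 hx).2 i hi h)

lemma mem_addSep {E : ι → Finset V} {i : ι} {x : V} (hx : x ∉ sepVars vars det S H) :
    x ∈ addSep vars det S H E i ↔ x ∈ E i := by
  unfold addSep
  split_ifs <;> simp [hx]

/-- Separators now occur in all subgoals, so they are comparable with every variable, and the
occurrences of all other variables are untouched. -/
lemma SafeOn.with_addSep {E : ι → Finset V} (h : SafeOn vars S H E) (hE : ∀ i ∈ S, vars i ⊆ E i) :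
    SafeOn vars S H (addSep vars det S H E) := by
  intro x hx y hy
  by_cases hxz : x ∈ sepVars vars det S H
  · exact .inr (.inl fun i hi _ => sepVars_subset_addSep hE hi hxz)
  by_cases hyz : y ∈ sepVars vars det S H
  · exact .inl fun i hi _ => sepVars_subset_addSep hE hi hyz
  simpa only [mem_addSep hxz, mem_addSep hyz] using h x hx y hy

/-- The variables that occur everywhere after `addSep` include the separators and disconnect the
query, so they contain a minimal such set. -/
lemma SafeOn.exists_cut {E : ι → Finset V} (h : SafeOn vars S H E) (h1 : ¬ S.card ≤ 1)
    (hE : ∀ i ∈ S, vars i ⊆ E i) :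
    ∃ w ∈ cuts vars det S H, ∀ i ∈ S, w ⊆ addSep vars det S H E i := by
  obtain ⟨w, hw, hwX⟩ := exists_cut_subset (det := det) (H := H) (S := S) (vars := vars)
    (Finset.filter_subset _ _)
    (fun x hx => Finset.mem_filter.2 ⟨sepVars_subset hx,
      fun i hi => sepVars_subset_addSep hE hi hx⟩)
    (h.with_addSep (det := det) hE |>.not_connected h1 fun i hi => (hE i hi).trans (subset_addSep i))
  exact ⟨w, hw, fun i hi x hx => (Finset.mem_filter.1 (hwX hx)).2 i hi⟩

lemma union_cut_sdiff_subset {w : Finset V} (S : Finset ι) :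
    varsOf vars S \ (H ∪ w) ⊆ varsOf vars S \ H :=
  Finset.sdiff_subset_sdiff subset_rfl Finset.subset_union_left

/-- Every safe dissociation dominates, on the probabilistic relations, some enumerated plan. -/
lemma exists_enumerated (hS : S.Nonempty) (hH : H ⊆ varsOf vars S) {E : ι → Finset V}
    (hE : ∀ i ∈ S, vars i ⊆ E i) (hEH : ∀ i ∈ S, H \ H₀ ⊆ E i) (h : SafeOn vars S H E) :
    ∃ P, Enumerated vars det S H P ∧ ∀ i ∈ S, i ∉ det → P.dissociation vars H₀ i ⊆ E i := by
  revert E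
  refine DP_induction (vars := vars) (det := det) (motive := fun S H => ∀ {E : ι → Finset V},
    (∀ i ∈ S, vars i ⊆ E i) → (∀ i ∈ S, H \ H₀ ⊆ E i) → SafeOn vars S H E →
    ∃ P, Enumerated vars det S H P ∧ ∀ i ∈ S, i ∉ det → P.dissociation vars H₀ i ⊆ E i)
    ?_ ?_ ?_ hS hH
  · intro i H hH E _ _ _
    exact ⟨_, .single i H hH, fun _ _ _ => Finset.empty_subset _⟩
  · intro S H hH hc ih E hE hEH hs
    have (c : {c // c ∈ components vars S H}) := ih c.1 c.2 (E := E)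
      (fun i hi => hE i (subset_of_mem_components c.2 hi))
      (fun i hi => (Finset.sdiff_subset_sdiff Finset.inter_subset_left subset_rfl).trans
        (hEH i (subset_of_mem_components c.2 hi))) (hs.component c.2)
    choose P hP hPE using this
    refine ⟨_, .join S H hH hc P hP, fun i hi hid => ?_⟩
    obtain ⟨c, hcc, hic⟩ := exists_mem_components (vars := vars) (H := H) hi
    rw [Enumerated.dissociation_components hH hP ⟨c, hcc⟩ hic]
    refine Finset.union_subset (subset_trans ?_ (hEH i hi)) (hPE ⟨c, hcc⟩ i hic hid)
    exact Finset.sdiff_subset_sdiff Finset.sdiff_subset subset_rfl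
  · intro S H hH h1 hc ih E hE hEH hs
    obtain ⟨w, hw, hwE⟩ := hs.exists_cut (det := det) h1 hE
    -- The recursion continues with the enlarged family; this is harmless because only deterministic
    -- subgoals were enlarged.
    obtain ⟨P, hP, hPE⟩ := ih w hw (E := addSep vars det S H E)
      (fun i hi => (hE i hi).trans (subset_addSep i))
      (fun i hi x hx => by
        rcases Finset.mem_union.1 (Finset.mem_sdiff.1 hx).1 with h | h
        · exact subset_addSep i (hEH i hi (Finset.mem_sdiff.2 ⟨h, (Finset.mem_sdiff.1 hx).2⟩))
        · exact hwE i hi h)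
      ((hs.with_addSep hE).mono subset_rfl (union_cut_sdiff_subset S))
    exact ⟨_, .proj S H w hH h1 hc hw P hP, fun i hi hid =>
      (hPE i hi hid).trans (addSep_of_notMem hid).subset⟩

namespace Enumerated

variable {P : Plan ι V}

/-- A safe dissociation below an enumerated plan agrees with it on the probabilistic relations. -/
lemma dissociation_subset_of_safe (hP : Enumerated vars det S H P) (h₀ : varsOf vars S ∩ H₀ ⊆ H)
    {E : ι → Finset V} (hE : ∀ i ∈ S, vars i ⊆ E i) (hEH : ∀ i ∈ S, H \ H₀ ⊆ E i)
    (h : SafeOn vars S H E)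
    (hEP : ∀ i ∈ S, ∀ x ∈ E i, x ∈ varsOf vars S \ H → x ∈ vars i ∪ P.dissociation vars H₀ i)
    {i : ι} (hi : i ∈ S) (hid : i ∉ det) : P.dissociation vars H₀ i ⊆ E i := by
  induction hP generalizing E with
  | single i H hH => exact Finset.empty_subset _
  | join S H hH hc P hP ih =>
    obtain ⟨c, hcc, hic⟩ := exists_mem_components (vars := vars) (H := H) hi
    have hcS := subset_of_mem_components hcc
    rw [Enumerated.dissociation_components hH hP ⟨c, hcc⟩ hic]
    refine Finset.union_subset (subset_trans ?_ (hEH i hi)) (ih ⟨c, hcc⟩ ?_ (fun i hi =>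
      hE i (hcS hi)) ?_ (h.component hcc) ?_ hic)
    · exact Finset.sdiff_subset_sdiff Finset.sdiff_subset subset_rfl
    · intro x hx
      simp only [Finset.mem_inter] at hx ⊢
      exact ⟨h₀ (Finset.mem_inter.2 ⟨varsOf_mono hcS hx.1, hx.2⟩), hx.1⟩
    · exact fun i hi => (Finset.sdiff_subset_sdiff Finset.inter_subset_left subset_rfl).trans
        (hEH i (hcS hi))
    · intro i hi x hx hxc
      have := hEP i (hcS hi) x hx (component_sdiff_subset hcc hxc)
      rw [dissociation_components hH hP ⟨c, hcc⟩ hi] at this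
      simp only [Finset.mem_sdiff, Finset.mem_union, Finset.mem_inter] at this hxc ⊢
      tauto
  | proj S H w hH h1 hc hw P hP ih =>
    have hE' := fun i hi => (hE i hi).trans (subset_addSep (vars := vars) (det := det) (S := S)
      (H := H) (E := E) i)
    have hmem := mem_cuts.1 hw
    have hwP := fun i hi => cut_subset_dissociation (i := i) h₀ hw hP hi
    set X := (varsOf vars S \ H).filter fun x => ∀ i ∈ S, x ∈ addSep vars det S H E i with hX
    have hzX : sepVars vars det S H ⊆ X := fun x hx => Finset.mem_filter.2
      ⟨sepVars_subset hx, fun i hi => sepVars_subset_addSep hE hi hx⟩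
    have hXw : X ⊆ w := by
      refine subset_cut (H₀ := H₀) hw hP ?_ fun i hi x hx => ?_
      · exact Finset.disjoint_left.2 fun x hx =>
          (Finset.mem_sdiff.1 (Finset.mem_filter.1 hx).1).2
      · by_cases hxz : x ∈ sepVars vars det S H
        · exact hwP i hi (hmem.2.1 hxz)
        · exact hEP i hi x ((mem_addSep hxz).1 ((Finset.mem_filter.1 hx).2 i hi))
            (Finset.mem_filter.1 hx).1
    -- `X` contains the separators and disconnects the query, so a proper inclusion would contradict
    -- minimality of the cut.
    have hXe : X = w := by
      by_contra hne
      exact (h.with_addSep hE).not_connected h1 hE' (hmem.2.2.2 X hzX (hXw.ssubset_of_ne hne))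
    refine (ih (E := addSep vars det S H E) (h₀.trans Finset.subset_union_left) hE' ?_
      ((h.with_addSep hE).mono subset_rfl (union_cut_sdiff_subset S)) ?_ hi).trans
      (addSep_of_notMem hid).subset
    · intro i hi x hx
      rcases Finset.mem_union.1 (Finset.mem_sdiff.1 hx).1 with h | h
      · exact subset_addSep i (hEH i hi (Finset.mem_sdiff.2 ⟨h, (Finset.mem_sdiff.1 hx).2⟩))
      · exact (Finset.mem_filter.1 (hXe ▸ h : x ∈ X)).2 i hi
    · intro i hi x hx hxw
      refine hEP i hi x ((mem_addSep fun hxz => ?_).1 hx) (union_cut_sdiff_subset S hxw)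
      exact (Finset.mem_sdiff.1 hxw).2 (Finset.mem_union_right _ (hmem.2.1 hxz))

/-- An enumerated plan is determined by its dissociation, and none dominates another. -/
lemma eq_of_dissociation_le (hP : Enumerated vars det S H P) {P' : Plan ι V}
    (hP' : Enumerated vars det S H P') (h₀ : varsOf vars S ∩ H₀ ⊆ H)
    (hle : ∀ i ∈ S, P'.dissociation vars H₀ i ⊆ P.dissociation vars H₀ i) : P' = P := by
  induction hP generalizing P' with
  | single i H hH =>
    generalize hS : ({i} : Finset ι) = S at hP'
    cases hP' with
    | single j => rw [Finset.singleton_inj.1 hS]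
    | join _ _ _ hc => exact absurd (connected_of_card_le_one (by simp [← hS])) hc
    | proj _ _ _ _ h1 => simp [← hS] at h1
  | join S H hH hc P hP ih =>
    cases hP' with
    | single => exact absurd (connected_of_card_le_one (by simp)) hc
    | proj _ _ _ _ _ hc' => exact absurd hc' hc
    | join _ _ _ _ P' hP' =>
      congr 1
      funext c
      refine ih c (hP' c) ?_ fun i hi => ?_
      · intro x hx
        simp only [Finset.mem_inter] at hx ⊢
        exact ⟨h₀ (Finset.mem_inter.2
          ⟨varsOf_mono (subset_of_mem_components c.2) hx.1, hx.2⟩), hx.1⟩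
      · intro x hx
        have h1 := hle i (subset_of_mem_components c.2 hi)
        rw [dissociation_components hH hP c hi, dissociation_components hH hP' c hi] at h1
        have h2 := h1 (Finset.mem_union_right _ hx)
        -- `x` occurs in the component, so it cannot come from the part `H \ varsOf vars c.1` that
        -- the join itself adds.
        have h3 := (hP' c).dissociation_subset hi hx
        simp only [Finset.mem_sdiff, Finset.mem_union] at h2 h3
        tauto
  | proj S H w hH h1 hc hw P hP ih =>
    cases hP' with
    | single => simp at h1
    | join _ _ _ hc' => exact absurd hc hc'
    | proj _ _ w' _ _ _ hw' P' hP' =>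
      -- The variables of `w'` reach all subgoals under `P'`, hence under `P`, and only those of `w`
      -- do so outside `H`.
      have hsub : w' ⊆ w := by
        refine subset_cut (H₀ := H₀) hw hP ?_ fun i hi => ?_
        · exact Finset.disjoint_left.2 fun x hx =>
            (Finset.mem_sdiff.1 ((mem_cuts.1 hw').1 hx)).2
        · exact (cut_subset_dissociation h₀ hw' hP' hi).trans
            (Finset.union_subset_union subset_rfl (hle i hi))
      have : w' = w := by
        by_contra hne
        exact (mem_cuts.1 hw').2.2.1
          ((mem_cuts.1 hw).2.2.2 w' (mem_cuts.1 hw').2.1 (hsub.ssubset_of_ne hne))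
      subst this
      rw [ih hP' (h₀.trans Finset.subset_union_left) hle]

/-- At a projection the variables of the cut occur everywhere. At a join an existential variable
stays within its component, so two of them are disjoint or are compared inside one operand. -/
lemma safeOn_dissociation (hP : Enumerated vars det S H P) (h₀ : varsOf vars S ∩ H₀ ⊆ H) :
    SafeOn vars S H fun i => vars i ∪ P.dissociation vars H₀ i := by
  induction hP with
  | single i H hH =>
    intro x hx y hy
    simp only [varsOf, Finset.singleton_biUnion, Finset.mem_sdiff] at hx hy
    exact .inl fun j hj _ => Finset.mem_union_left _ (Finset.mem_singleton.1 hj ▸ hy.1)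
  | join S H hH hc P hP ih =>
    have hmem : ∀ c (hcc : c ∈ components vars S H), ∀ i ∈ c, ∀ x ∈ varsOf vars S \ H,
        (x ∈ vars i ∪ (Plan.join _ P).dissociation vars H₀ i ↔
          x ∈ vars i ∪ (P ⟨c, hcc⟩).dissociation vars H₀ i) := by
      intro c hcc i hi x hx
      rw [dissociation_components hH hP ⟨c, hcc⟩ hi]
      simp only [Finset.mem_sdiff, Finset.mem_union] at hx ⊢
      tauto
    have hloc : ∀ c (hcc : c ∈ components vars S H), ∀ i ∈ c, ∀ x ∈ varsOf vars S \ H,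
        x ∈ vars i ∪ (Plan.join _ P).dissociation vars H₀ i → x ∈ varsOf vars c := by
      intro c hcc i hi x hx hxi
      rcases Finset.mem_union.1 ((hmem c hcc i hi x hx).1 hxi) with h | h
      · exact mem_varsOf.2 ⟨i, hi, h⟩
      · exact (Finset.mem_sdiff.1 ((hP ⟨c, hcc⟩).dissociation_subset hi h)).1
    intro x hx y hy
    obtain ⟨i, hi, hxi⟩ := mem_varsOf.1 (Finset.mem_sdiff.1 hx).1
    obtain ⟨c, hcc, hic⟩ := exists_mem_components (vars := vars) (H := H) hi
    have hxc := mem_varsOf.2 ⟨i, hic, hxi⟩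
    have hin : ∀ j ∈ S, x ∈ vars j ∪ (Plan.join _ P).dissociation vars H₀ j → j ∈ c := by
      intro j hj hxj
      obtain ⟨d, hd, hjd⟩ := exists_mem_components (vars := vars) (H := H) hj
      rwa [components_eq_of_mem_varsOf hcc hd hxc (hloc d hd j hjd x hx hxj)
        (Finset.mem_sdiff.1 hx).2]
    by_cases hyc : y ∈ varsOf vars c
    · have hin' : ∀ j ∈ S, y ∈ vars j ∪ (Plan.join _ P).dissociation vars H₀ j → j ∈ c := by
        intro j hj hyj
        obtain ⟨d, hd, hjd⟩ := exists_mem_components (vars := vars) (H := H) hj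
        rwa [components_eq_of_mem_varsOf hcc hd hyc (hloc d hd j hjd y hy hyj)
          (Finset.mem_sdiff.1 hy).2]
      have hx' := (Finset.mem_sdiff.1 hx).2
      have hy' := (Finset.mem_sdiff.1 hy).2
      have h₀' : varsOf vars c ∩ H₀ ⊆ H ∩ varsOf vars c := by
        intro x hx
        simp only [Finset.mem_inter] at hx ⊢
        exact ⟨h₀ (Finset.mem_inter.2
          ⟨varsOf_mono (subset_of_mem_components hcc) hx.1, hx.2⟩), hx.1⟩
      rcases ih ⟨c, hcc⟩ h₀' x (by simp [hxc, hx']) y (by simp [hyc, hy']) with h | h | h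
      · refine .inl fun j hj hxj => ?_
        have hjc := hin j hj hxj
        rw [hmem c hcc j hjc _ hx] at hxj
        rw [hmem c hcc j hjc _ hy]
        exact h j hjc hxj
      · refine .inr (.inl fun j hj hyj => ?_)
        have hjc := hin' j hj hyj
        rw [hmem c hcc j hjc _ hy] at hyj
        rw [hmem c hcc j hjc _ hx]
        exact h j hjc hyj
      · refine .inr (.inr fun j hj hxj => ?_)
        have hjc := hin j hj hxj
        rw [hmem c hcc j hjc _ hx] at hxj
        rw [hmem c hcc j hjc _ hy]
        exact h j hjc hxj
    · exact .inr (.inr fun j hj hxj hyj => hyc (hloc c hcc j (hin j hj hxj) y hy hyj))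
  | proj S H w hH h1 hc hw P hP ih =>
    have hwP := fun i hi => cut_subset_dissociation (i := i) h₀ hw hP hi
    intro x hx y hy
    by_cases hxw : x ∈ w
    · exact .inr (.inl fun i hi _ => hwP i hi hxw)
    by_cases hyw : y ∈ w
    · exact .inl fun i hi _ => hwP i hi hyw
    simp only [Finset.mem_sdiff] at hx hy
    exact ih (h₀.trans Finset.subset_union_left) x (by simp [hx.1, hx.2, hxw]) y
      (by simp [hy.1, hy.2, hyw])

end Enumerated

end PlanEnum

/-! ### Random worlds of a tuple-independent database -/

section WorldProbability

variable {α β : Type*} {p : α → ℝ}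

/-- The probability of the world `W` if the elements of `T` are present independently. -/
noncomputable def worldWeight (T : Finset α) (p : α → ℝ) (W : Finset α) : ℝ :=
  (∏ e ∈ W, p e) * ∏ e ∈ T \ W, (1 - p e)

/-- The probability of the event `A` in a random world on `T`. -/
noncomputable def worldProb (T : Finset α) (p : α → ℝ) (A : Finset α → Prop) : ℝ :=
  ∑ W ∈ T.powerset, worldWeight T p W * if A W then 1 else 0

lemma worldWeight_nonneg {T W : Finset α} (h0 : ∀ e ∈ T, 0 ≤ p e) (h1 : ∀ e ∈ T, p e ≤ 1)
    (hW : W ⊆ T) : 0 ≤ worldWeight T p W :=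
  mul_nonneg (Finset.prod_nonneg fun e he => h0 e (hW he))
    (Finset.prod_nonneg fun e he => sub_nonneg.2 (h1 e (Finset.sdiff_subset he)))

lemma worldProb_congr {T : Finset α} {A B : Finset α → Prop} (h : ∀ W ⊆ T, (A W ↔ B W)) :
    worldProb T p A = worldProb T p B :=
  Finset.sum_congr rfl fun W hW => by simp only [h W (Finset.mem_powerset.1 hW)]

lemma worldProb_mono {T : Finset α} {A B : Finset α → Prop} (h0 : ∀ e ∈ T, 0 ≤ p e)
    (h1 : ∀ e ∈ T, p e ≤ 1) (h : ∀ W ⊆ T, A W → B W) : worldProb T p A ≤ worldProb T p B := by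
  refine Finset.sum_le_sum fun W hW => ?_
  have hW := Finset.mem_powerset.1 hW
  refine mul_le_mul_of_nonneg_left ?_ (worldWeight_nonneg h0 h1 hW)
  have := h W hW
  by_cases hA : A W
  · simp [hA, this hA]
  · simp only [hA, if_false]
    split_ifs <;> norm_num

lemma sum_worldWeight (T : Finset α) : ∑ W ∈ T.powerset, worldWeight T p W = 1 := by
  have := Finset.prod_add p (fun e => 1 - p e) T
  simp only [add_sub_cancel, Finset.prod_const_one] at this
  rw [this]
  rfl

lemma worldProb_const {T : Finset α} {A : Finset α → Prop} (c : Prop) (h : ∀ W ⊆ T, (A W ↔ c)) :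
    worldProb T p A = if c then 1 else 0 := by
  rw [worldProb_congr h, worldProb, ← Finset.sum_mul, sum_worldWeight, one_mul]

lemma worldProb_not (T : Finset α) (A : Finset α → Prop) :
    worldProb T p (fun W => ¬ A W) = 1 - worldProb T p A := by
  rw [eq_sub_iff_add_eq]
  refine Eq.trans ?_ (sum_worldWeight (p := p) T)
  rw [worldProb, worldProb, ← Finset.sum_add_distrib]
  refine Finset.sum_congr rfl fun W _ => ?_
  by_cases h : A W <;> simp [h]

/-- Worlds on a disjoint union are pairs of worlds with product weights; this conditions on the
first one. -/
lemma worldProb_union {T₁ T₂ : Finset α} (hd : Disjoint T₁ T₂) (A : Finset α → Prop) :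
    worldProb (T₁ ∪ T₂) p A =
      ∑ K ∈ T₁.powerset, worldWeight T₁ p K * worldProb T₂ p fun W => A (K ∪ W) := by
  simp only [worldProb, Finset.mul_sum]
  rw [← Finset.sum_product']
  symm
  refine Finset.sum_nbij' (fun K => K.1 ∪ K.2) (fun U => (U ∩ T₁, U ∩ T₂)) ?_ ?_ ?_ ?_ ?_
  · intro K hK
    simp only [Finset.mem_product, Finset.mem_powerset] at hK ⊢
    exact Finset.union_subset_union hK.1 hK.2
  · intro U _
    simp [Finset.inter_subset_right]
  · rintro ⟨K, W⟩ hK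
    simp only [Finset.mem_product, Finset.mem_powerset] at hK
    have h1 : W ∩ T₁ = ∅ := Finset.disjoint_iff_inter_eq_empty.1 (hd.symm.mono_left hK.2)
    have h2 : K ∩ T₂ = ∅ := Finset.disjoint_iff_inter_eq_empty.1 (hd.mono_left hK.1)
    simp [Finset.union_inter_distrib_right, h1, h2, Finset.inter_eq_left.2 hK.1,
      Finset.inter_eq_left.2 hK.2]
  · intro U hU
    rw [← Finset.inter_union_distrib_left]
    exact Finset.inter_eq_left.2 (Finset.mem_powerset.1 hU)
  · rintro ⟨K, W⟩ hK
    simp only [Finset.mem_product, Finset.mem_powerset] at hK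
    have h1 : (T₁ ∪ T₂) \ (K ∪ W) = (T₁ \ K) ∪ (T₂ \ W) := by
      ext x
      have a := @hK.1 x
      have b := @hK.2 x
      have c := @Finset.disjoint_left.1 hd x
      simp only [Finset.mem_sdiff, Finset.mem_union]
      tauto
    simp only [worldWeight]
    rw [h1, Finset.prod_union (hd.mono hK.1 hK.2),
      Finset.prod_union (hd.mono Finset.sdiff_subset Finset.sdiff_subset)]
    ring

lemma worldProb_insert {T : Finset α} {t : α} (ht : t ∉ T) (A : Finset α → Prop) :
    worldProb (insert t T) p A =
      p t * worldProb T p (fun W => A (insert t W)) + (1 - p t) * worldProb T p A := by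
  rw [Finset.insert_eq, worldProb_union (Finset.disjoint_singleton_left.2 ht),
    ← insert_empty_eq, Finset.sum_powerset_insert (Finset.notMem_empty t)]
  simp [worldWeight, add_comm]

/-- The event `A` depends only on the presence of the elements of `F`. -/
def EventOn (F : Set α) (A : Finset α → Prop) : Prop :=
  ∀ W W' : Finset α, (∀ e ∈ F, e ∈ W ↔ e ∈ W') → (A W ↔ A W')

lemma EventOn.not {F : Set α} {A : Finset α → Prop} (h : EventOn F A) :
    EventOn F fun W => ¬ A W := fun W W' hW => not_congr (h W W' hW)

/-- Conditioning on the part of the world inside `F` decides `A` and leaves `B` to the rest. -/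
lemma worldProb_and {T : Finset α} {F G : Set α} {A B : Finset α → Prop} (hA : EventOn F A)
    (hB : EventOn G B) (hd : Disjoint F G) :
    worldProb T p (fun W => A W ∧ B W) = worldProb T p A * worldProb T p B := by
  set T₁ := T.filter (· ∈ F) with hT₁
  set T₂ := T.filter (· ∉ F) with hT₂
  have hT : T = T₁ ∪ T₂ := (Finset.filter_union_filter_not_eq _ T).symm
  have hdT : Disjoint T₁ T₂ := Finset.disjoint_filter_filter_not _ _ _
  have hA' : ∀ K ⊆ T₁, ∀ W ⊆ T₂, (A (K ∪ W) ↔ A K) := fun K hK W hW => hA _ _ fun e he => by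
    have : e ∉ W := fun h => (Finset.mem_filter.1 (hW h)).2 he
    simp [this]
  have hB' : ∀ K ⊆ T₁, ∀ W ⊆ T₂, (B (K ∪ W) ↔ B W) := fun K hK W hW => hB _ _ fun e he => by
    have : e ∉ K := fun h => Set.disjoint_left.1 hd (Finset.mem_filter.1 (hK h)).2 he
    simp [this]
  have e1 : worldProb T p A = worldProb T₁ p A := by
    rw [hT, worldProb_union hdT]
    refine Finset.sum_congr rfl fun K hK => ?_
    rw [worldProb_const (A K) (hA' K (Finset.mem_powerset.1 hK))]
  have e2 : worldProb T p B = worldProb T₂ p B := by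
    rw [hT, worldProb_union hdT, ← one_mul (worldProb T₂ p B), ← sum_worldWeight T₁,
      Finset.sum_mul]
    refine Finset.sum_congr rfl fun K hK => ?_
    rw [worldProb_congr (hB' K (Finset.mem_powerset.1 hK))]
  rw [e1, e2, hT, worldProb_union hdT, worldProb, Finset.sum_mul]
  refine Finset.sum_congr rfl fun K hK => ?_
  have hK := Finset.mem_powerset.1 hK
  rw [mul_assoc]
  congr 1
  by_cases h : A K
  · rw [if_pos h, one_mul]
    exact worldProb_congr fun W hW => by simp [hA' K hK W hW, hB' K hK W hW, h]
  · rw [if_neg h, zero_mul, worldProb_const False fun W hW => by simp [hA' K hK W hW, h]]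
    simp

lemma worldProb_forall {γ : Type*} {T : Finset α} (s : Finset γ) {F : γ → Set α}
    {A : γ → Finset α → Prop} (hA : ∀ c ∈ s, EventOn (F c) (A c))
    (hd : ∀ c ∈ s, ∀ d ∈ s, c ≠ d → Disjoint (F c) (F d)) :
    worldProb T p (fun W => ∀ c ∈ s, A c W) = ∏ c ∈ s, worldProb T p (A c) := by
  induction s using Finset.induction_on with
  | empty => simpa using worldProb_const (p := p) (T := T) True (fun W _ => by simp)
  | insert c s hc ih =>
    rw [Finset.prod_insert hc, ← ih (fun d hd => hA d (Finset.mem_insert_of_mem hd))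
      fun d hd' e he => hd d (Finset.mem_insert_of_mem hd') e (Finset.mem_insert_of_mem he)]
    rw [← worldProb_and (hA c (Finset.mem_insert_self c s))
      (G := ⋃ d ∈ s, F d) (B := fun W => ∀ d ∈ s, A d W)]
    · simp only [Finset.forall_mem_insert]
    · intro W W' h
      refine forall₂_congr fun d hd => hA d (Finset.mem_insert_of_mem hd) W W' fun e he => h e ?_
      exact Set.mem_biUnion hd he
    · rw [Set.disjoint_iUnion₂_right]
      intro d hds
      exact hd c (Finset.mem_insert_self c s) d (Finset.mem_insert_of_mem hds)
        fun h => hc (h ▸ hds)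

lemma worldProb_exists {γ : Type*} {T : Finset α} (s : Finset γ) {F : γ → Set α}
    {A : γ → Finset α → Prop} (hA : ∀ c ∈ s, EventOn (F c) (A c))
    (hd : ∀ c ∈ s, ∀ d ∈ s, c ≠ d → Disjoint (F c) (F d)) :
    worldProb T p (fun W => ∃ c ∈ s, A c W) = 1 - ∏ c ∈ s, (1 - worldProb T p (A c)) := by
  simp only [← worldProb_not]
  rw [← worldProb_forall s (fun c hc => (hA c hc).not) hd, ← worldProb_not]
  exact worldProb_congr fun W _ => by push Not; rfl

lemma worldProb_mem (T : Finset α) (t : α) :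
    worldProb T p (fun W => t ∈ W) = if t ∈ T then p t else 0 := by
  split_ifs with h
  · rw [← Finset.insert_erase h, worldProb_insert (Finset.notMem_erase t T),
      worldProb_const True (fun W _ => by simp), worldProb_const False fun W hW => by
        simpa using fun h => Finset.notMem_erase t T (hW h)]
    simp
  · rw [worldProb_const False fun W hW => by simpa using fun h' => h (hW h')]
    simp

/-- Every world that misses a tuple has weight zero. -/
lemma worldProb_of_eq_one {T : Finset α} (h : ∀ e ∈ T, p e = 1) (A : Finset α → Prop) :
    worldProb T p A = if A T then 1 else 0 := by
  rw [worldProb, Finset.sum_eq_single T]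
  · simp [worldWeight, Finset.prod_congr rfl h]
  · intro W hW hne
    obtain ⟨e, he, heW⟩ := Finset.exists_of_ssubset
      ((Finset.mem_powerset.1 hW).ssubset_of_ne hne)
    have : ∏ e ∈ T \ W, (1 - p e) = 0 :=
      Finset.prod_eq_zero (Finset.mem_sdiff.2 ⟨he, heW⟩) (by rw [h e he, sub_self])
    rw [worldWeight, this, mul_zero, zero_mul]
  · exact fun h => absurd (Finset.mem_powerset_self T) h

/-! ### Replacing tuples by independent copies -/

section Copies

variable {f : β → α}

/-- The copies in `T'` of the elements of `W`. -/
noncomputable def copiesOf (f : β → α) (T' : Finset β) (W : Finset α) : Finset β :=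
  T'.filter (f · ∈ W)

lemma mem_copiesOf {T' : Finset β} {W : Finset α} {e : β} :
    e ∈ copiesOf f T' W ↔ e ∈ T' ∧ f e ∈ W := by simp [copiesOf]

lemma filter_insert_copies {T' : Finset β} {t : α} {W : Finset α} :
    copiesOf f T' (insert t W) =
      copiesOf f (T'.filter (f · ≠ t)) W ∪ T'.filter (f · = t) := by
  ext e
  simp only [mem_copiesOf, Finset.mem_filter, Finset.mem_insert, Finset.mem_union]
  tauto

lemma filter_copies {T' : Finset β} {t : α} {W : Finset α} (ht : t ∉ W) :
    copiesOf f T' W = copiesOf f (T'.filter (f · ≠ t)) W := by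
  ext e
  simp only [mem_copiesOf, Finset.mem_filter]
  constructor
  · rintro ⟨h1, h2⟩
    exact ⟨⟨h1, fun h => ht (h ▸ h2)⟩, h2⟩
  · exact fun h => ⟨h.1.1, h.2⟩

/-- Splitting off the copies of one tuple. -/
lemma worldProb_copies_split (T' : Finset β) (t : α) (E : Finset β → Prop) :
    worldProb T' (p ∘ f) E = ∑ W ∈ (T'.filter (f · ≠ t)).powerset,
      worldWeight (T'.filter (f · ≠ t)) (p ∘ f) W *
        worldProb (T'.filter (f · = t)) (p ∘ f) fun K => E (W ∪ K) := by
  rw [← worldProb_union]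
  · congr 1
    ext e
    simp only [Finset.mem_filter, Finset.mem_union]
    tauto
  · rw [Finset.disjoint_left]
    intro e h1 h2
    exact (Finset.mem_filter.1 h1).2 (Finset.mem_filter.1 h2).2

lemma worldProb_insert_copies {T : Finset α} {T' : Finset β} {t : α} (ht : t ∉ T)
    (E : Finset β → Prop) :
    worldProb (insert t T) p (fun W => E (copiesOf f T' W)) =
      p t * worldProb T p (fun W =>
        E (copiesOf f (T'.filter (f · ≠ t)) W ∪ T'.filter (f · = t))) +
      (1 - p t) * worldProb T p (fun W => E (copiesOf f (T'.filter (f · ≠ t)) W)) := by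
  rw [worldProb_insert ht]
  simp only [filter_insert_copies]
  congr 2
  exact worldProb_congr fun W hW => by rw [filter_copies fun h => ht (hW h)]

/-- The case of one tuple: on the left its copies come and go together, on the right independently.
If the event needs a copy, a single one suffices, and that copy alone already has probability `p t`.
-/
lemma le_worldProb_copies {C : Finset β} {t : α} (hC : ∀ e ∈ C, f e = t) (h0 : 0 ≤ p t)
    (h1 : p t ≤ 1) {G : Finset β → Prop} (hG : ∀ K K', K ⊆ K' → G K → G K')
    (hsing : G C → G ∅ ∨ ∃ c ∈ C, G {c}) :
    (p t * if G C then 1 else 0) + ((1 - p t) * if G ∅ then 1 else 0) ≤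
      worldProb C (p ∘ f) G := by
  have h0' : ∀ e ∈ C, 0 ≤ (p ∘ f) e := fun e he => by simpa [hC e he] using h0
  have h1' : ∀ e ∈ C, (p ∘ f) e ≤ 1 := fun e he => by simpa [hC e he] using h1
  by_cases hE : G ∅
  · rw [worldProb_const True fun K _ => by simpa using hG _ _ (Finset.empty_subset K) hE]
    simp [hE, hG _ _ (Finset.empty_subset C) hE]
  by_cases hCC : G C
  · obtain ⟨c, hc, hGc⟩ := (hsing hCC).resolve_left hE
    have := worldProb_mono (p := p ∘ f) (T := C) (A := fun K => c ∈ K) (B := G) h0' h1'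
      fun K _ hcK => hG _ _ (Finset.singleton_subset_iff.2 hcK) hGc
    rw [worldProb_mem, if_pos hc] at this
    simpa [hE, hCC, hC c hc] using this
  · simp only [hE, hCC, if_false, mul_zero, add_zero]
    exact Finset.sum_nonneg fun K hK => mul_nonneg
      (worldWeight_nonneg h0' h1' (Finset.mem_powerset.1 hK)) (by split_ifs <;> norm_num)

/-- Replacing tuples by independent copies does not decrease the probability of a monotone event
whose minimal witnesses contain at most one copy of each tuple. -/
theorem worldProb_le_copies {T : Finset α} {T' : Finset β} (hf : ∀ e ∈ T', f e ∈ T)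
    (h0 : ∀ t ∈ T, 0 ≤ p t) (h1 : ∀ t ∈ T, p t ≤ 1) {E : Finset β → Prop}
    (hE : ∀ W W', W ⊆ W' → E W → E W')
    (hinj : ∀ W, E W → ∃ W' ⊆ W, E W' ∧ Set.InjOn f W') :
    worldProb T p (fun W => E (copiesOf f T' W)) ≤ worldProb T' (p ∘ f) E := by
  induction T using Finset.induction_on generalizing T' E with
  | empty =>
    obtain rfl : T' = ∅ := Finset.eq_empty_of_forall_notMem fun e he => by simpa using hf e he
    simp [worldProb, worldWeight, copiesOf]
  | insert t T ht ih =>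
    rw [worldProb_insert_copies ht, worldProb_copies_split T' t]
    set T₀ := T'.filter (f · ≠ t) with hT₀
    set C := T'.filter (f · = t) with hC
    have hp0 := h0 t (Finset.mem_insert_self t T)
    have hp1 := h1 t (Finset.mem_insert_self t T)
    have h0' := fun s hs => h0 s (Finset.mem_insert_of_mem hs)
    have h1' := fun s hs => h1 s (Finset.mem_insert_of_mem hs)
    have hf' : ∀ e ∈ T₀, f e ∈ T := fun e he => by
      have := Finset.mem_filter.1 he
      exact (Finset.mem_insert.1 (hf e this.1)).resolve_left this.2
    have i1 := ih (E := fun W => E (W ∪ C)) hf' h0' h1'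
      (fun W W' h => hE _ _ (Finset.union_subset_union h subset_rfl)) (fun W hW => by
        obtain ⟨W', hsub, hEW, hi⟩ := hinj _ hW
        -- Cutting the witness down to `W` loses only copies of `t`, which this event supplies
        -- anyway.
        refine ⟨W' ∩ W, Finset.inter_subset_right, hE _ _ (fun e he => ?_) hEW,
          hi.mono (by simp)⟩
        have := hsub he
        simp only [Finset.mem_union, Finset.mem_inter] at this ⊢
        tauto)
    have i2 := ih (E := E) hf' h0' h1' hE hinj
    refine (add_le_add (mul_le_mul_of_nonneg_left i1 hp0)
      (mul_le_mul_of_nonneg_left i2 (sub_nonneg.2 hp1))).trans ?_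
    rw [worldProb, worldProb, Finset.mul_sum, Finset.mul_sum, ← Finset.sum_add_distrib]
    refine Finset.sum_le_sum fun W hW => ?_
    have hW := Finset.mem_powerset.1 hW
    rw [mul_left_comm (p t), mul_left_comm (1 - p t), ← mul_add]
    refine mul_le_mul_of_nonneg_left ?_ (worldWeight_nonneg
      (fun e he => h0' _ (hf' e he)) (fun e he => h1' _ (hf' e he)) hW)
    have := le_worldProb_copies (C := C) (p := p) (f := f)
      (fun e he => (Finset.mem_filter.1 he).2) hp0 hp1
      (G := fun K => E (W ∪ K))
      (fun K K' h => hE _ _ (Finset.union_subset_union subset_rfl h)) ?_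
    · simpa only [Finset.union_empty] using this
    · intro hWC
      obtain ⟨W', hsub, hEW, hi⟩ := hinj _ hWC
      -- By injectivity the witness uses at most one copy of `t`; the rest of it lies in `W`.
      by_cases hex : ∃ c ∈ W', c ∈ C
      · obtain ⟨c, hcW, hcC⟩ := hex
        refine .inr ⟨c, hcC, hE _ _ (fun e he => ?_) hEW⟩
        rcases Finset.mem_union.1 (hsub he) with h | h
        · exact Finset.mem_union_left _ h
        · rw [hi he hcW ((Finset.mem_filter.1 h).2.trans (Finset.mem_filter.1 hcC).2.symm)]
          simp
      · refine .inl (hE _ _ (fun e he => ?_) hEW)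
        rcases Finset.mem_union.1 (hsub he) with h | h
        · exact Finset.mem_union_left _ h
        · exact absurd ⟨e, he, h⟩ hex

/-- The set `s` holds the only copy of `t` that the event can see. Either the world of all copies is
certain, or the event is decided by the presence of that one copy. -/
lemma worldProb_copies_eq {C : Finset β} {t : α} (hC : ∀ e ∈ C, f e = t) {G : Finset β → Prop}
    (h : p t = 1 ∨ ∃ s : Set β, s.Subsingleton ∧ EventOn {e | f e = t → e ∈ s} G) :
    worldProb C (p ∘ f) G =
      (p t * if G C then 1 else 0) + ((1 - p t) * if G ∅ then 1 else 0) := by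
  rcases h with h | ⟨s, hs, hG⟩
  · rw [worldProb_of_eq_one fun e he => by simp [hC e he, h]]
    simp [h]
  by_cases hex : ∃ c ∈ C, c ∈ s
  · obtain ⟨c, hc, hcs⟩ := hex
    have key : ∀ K ⊆ C, ∀ K' ⊆ C, (c ∈ K ↔ c ∈ K') → (G K ↔ G K') := by
      intro K hK K' hK' hcK
      refine hG K K' fun e he => ?_
      by_cases heC : e ∈ C
      · rw [hs (he (hC e heC)) hcs]
        exact hcK
      · exact iff_of_false (fun h => heC (hK h)) fun h => heC (hK' h)
    rw [← Finset.insert_erase hc, worldProb_insert (Finset.notMem_erase c C),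
      Finset.insert_erase hc, worldProb_const (G C) fun K hK => ?_,
      worldProb_const (G ∅) fun K hK => ?_]
    · simp [hC c hc]
    · refine key K (hK.trans (Finset.erase_subset c C)) ∅ (Finset.empty_subset _) ?_
      simpa using fun h => Finset.notMem_erase c C (hK h)
    · refine key _ ?_ C subset_rfl (by simp [hc])
      exact Finset.insert_subset hc (hK.trans (Finset.erase_subset c C))
  · have key : ∀ K ⊆ C, (G K ↔ G ∅) := by
      intro K hK
      refine hG K ∅ fun e he => ?_
      simp only [Finset.notMem_empty, iff_false]
      exact fun h => hex ⟨e, hK h, he (hC e (hK h))⟩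
    rw [worldProb_const (G ∅) key]
    by_cases hGe : G ∅ <;> simp [hGe, key C subset_rfl]

/-- Replacing tuples by independent copies does not change the probability of an event that
depends, for each uncertain tuple, on at most one of its copies. -/
theorem worldProb_eq_copies {T : Finset α} {T' : Finset β} (hf : ∀ e ∈ T', f e ∈ T)
    {E : Finset β → Prop} (h : ∀ t ∈ T, p t = 1 ∨
      ∃ s : Set β, s.Subsingleton ∧ EventOn {e | f e = t → e ∈ s} E) :
    worldProb T p (fun W => E (copiesOf f T' W)) = worldProb T' (p ∘ f) E := by
  induction T using Finset.induction_on generalizing T' E with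
  | empty =>
    obtain rfl : T' = ∅ := Finset.eq_empty_of_forall_notMem fun e he => by simpa using hf e he
    simp [worldProb, worldWeight, copiesOf]
  | insert t T ht ih =>
    rw [worldProb_insert_copies ht, worldProb_copies_split T' t]
    have hf' : ∀ e ∈ T'.filter (f · ≠ t), f e ∈ T := fun e he => by
      have := Finset.mem_filter.1 he
      exact (Finset.mem_insert.1 (hf e this.1)).resolve_left this.2
    rw [ih (E := fun W => E (W ∪ T'.filter (f · = t))) hf', ih (E := E) hf' fun s hs =>
      h s (Finset.mem_insert_of_mem hs)]
    · rw [worldProb, worldProb, Finset.mul_sum, Finset.mul_sum, ← Finset.sum_add_distrib]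
      refine Finset.sum_congr rfl fun W hW => ?_
      rw [mul_left_comm (p t), mul_left_comm (1 - p t), ← mul_add]
      congr 1
      have := worldProb_copies_eq (C := T'.filter (f · = t)) (p := p) (f := f)
        (fun e he => (Finset.mem_filter.1 he).2) (G := fun K => E (W ∪ K)) ?_
      · simpa only [Finset.union_empty] using this.symm
      · refine (h t (Finset.mem_insert_self t T)).imp_right fun ⟨s, hs, hEs⟩ => ⟨s, hs, ?_⟩
        exact fun K K' hK => hEs _ _ fun e he => by simp [hK e he]
    · intro s hs
      refine (h s (Finset.mem_insert_of_mem hs)).imp_right fun ⟨u, hu, hEu⟩ => ⟨u, hu, ?_⟩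
      exact fun K K' hK => hEu _ _ fun e he => by simp [hK e he]

end Copies

end WorldProbability

namespace CQ

variable {ι V U : Type*} [Fintype ι] {q : CQ ι V U} {Δ Δ' Δ₀ : ι → Finset V} {D : PDB q.arity U}

/-! ### Tuples of the dissociated database -/

/-- The tuple of relation `i` of the dissociated query under a valuation. -/
def groundTuple (q : CQ ι V U) (Δ : ι → Finset V) (θ : V → U) (i : ι) : q.DissTuple Δ :=
  ⟨i, q.ground θ i, fun x => θ x⟩

lemma mem_atomVars {i : ι} {x : V} : x ∈ q.atomVars i ↔ ∃ k, q.args i k = Sum.inl x := by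
  simp only [atomVars, Finset.mem_biUnion, Finset.mem_univ, true_and]
  refine exists_congr fun k => ?_
  cases q.args i k <;> simp [eq_comm]

lemma mem_vars {x : V} : x ∈ q.vars ↔ ∃ i, x ∈ q.atomVars i := by
  simp [vars]

lemma atomVars_subset_vars (i : ι) : q.atomVars i ⊆ q.vars := fun _ hx => mem_vars.2 ⟨i, hx⟩

lemma head_subset_vars : q.head ⊆ q.vars := fun x hx => by
  obtain ⟨i, k, h⟩ := q.head_subset x hx
  exact mem_vars.2 ⟨i, mem_atomVars.2 ⟨k, h⟩⟩

lemma ground_eq_iff {θ θ' : V → U} {i : ι} :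
    q.ground θ i = q.ground θ' i ↔ ∀ x ∈ q.atomVars i, θ x = θ' x := by
  constructor
  · intro h x hx
    obtain ⟨k, hk⟩ := mem_atomVars.1 hx
    simpa [ground, hk] using congrFun h k
  · intro h
    funext k
    have := fun x hx => h x (mem_atomVars.2 ⟨k, hx⟩)
    unfold ground
    cases hk : q.args i k with
    | inl x => exact this x hk
    | inr u => rfl

lemma groundTuple_eq_iff {θ θ' : V → U} {i j : ι} :
    q.groundTuple Δ θ i = q.groundTuple Δ θ' j ↔ i = j ∧ ∀ x ∈ q.dissVars Δ i, θ x = θ' x := by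
  constructor
  · intro h
    obtain rfl : i = j := congrArg Sigma.fst h
    have h' := Prod.ext_iff.1 (eq_of_heq (Sigma.mk.inj h).2)
    refine ⟨rfl, fun x hx => ?_⟩
    rcases Finset.mem_union.1 hx with hx | hx
    · exact ground_eq_iff.1 h'.1 x hx
    · exact congrFun h'.2 ⟨x, hx⟩
  · rintro ⟨rfl, h⟩
    have h1 : q.ground θ i = q.ground θ' i :=
      ground_eq_iff.2 fun x hx => h x (Finset.mem_union_left _ hx)
    have h2 : (fun x : {x // x ∈ Δ i} => θ x.1) = fun x => θ' x.1 :=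
      funext fun x => h x (Finset.mem_union_right _ x.2)
    unfold groundTuple
    rw [h1, h2]

lemma groundTuple_mem_dissTuples {θ : V → U} {i : ι} :
    q.groundTuple Δ θ i ∈ q.dissTuples Δ D ↔
      q.ground θ i ∈ D.tuples i ∧ ∀ x ∈ Δ i, θ x ∈ D.activeDomain := by
  simp [groundTuple, dissTuples, Fintype.mem_piFinset]

lemma mem_activeDomain_of_ground {θ : V → U} {i : ι} (h : q.ground θ i ∈ D.tuples i) {x : V}
    (hx : x ∈ q.atomVars i) : θ x ∈ D.activeDomain := by
  obtain ⟨k, hk⟩ := mem_atomVars.1 hx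
  simp only [PDB.activeDomain, Finset.mem_biUnion, Finset.mem_univ, true_and, Finset.mem_image]
  exact ⟨i, _, h, k, by simp [ground, hk]⟩

lemma mem_activeDomain_of_mem_dissTuples {θ : V → U} {i : ι}
    (h : q.groundTuple Δ θ i ∈ q.dissTuples Δ D) {x : V} (hx : x ∈ q.dissVars Δ i) :
    θ x ∈ D.activeDomain := by
  rw [groundTuple_mem_dissTuples] at h
  rcases Finset.mem_union.1 hx with hx | hx
  exacts [mem_activeDomain_of_ground h.1 hx, h.2 x hx]

/-- The probability of a tuple of the dissociated database. -/
noncomputable def tupleProb (q : CQ ι V U) (Δ : ι → Finset V) (D : PDB q.arity U) :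
    q.DissTuple Δ → ℝ := fun e => D.prob e.1 e.2.1

lemma fst_mem_of_mem_dissTuples {e : q.DissTuple Δ} (he : e ∈ q.dissTuples Δ D) :
    e.2.1 ∈ D.tuples e.1 := by
  simp only [dissTuples, Finset.mem_sigma, Finset.mem_product] at he
  exact he.2.1

lemma reliability_eq_worldProb (a : V → U) :
    q.reliability Δ D a =
      worldProb (q.dissTuples Δ D) (q.tupleProb Δ D) fun W => q.HoldsIn Δ W a := by
  rw [reliability, worldProb, Finset.sum_filter]
  refine Finset.sum_congr rfl fun W _ => ?_
  rw [mul_ite, mul_one, mul_zero, worldWeight]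
  congr!

/-! ### The effect of further dissociation on the reliability -/

/-- Forgetting the values of the variables in `Δ' i \ Δ i`. -/
def restrictTuple (q : CQ ι V U) (h : Δ ≤ Δ') (e : q.DissTuple Δ') : q.DissTuple Δ :=
  ⟨e.1, e.2.1, fun x => e.2.2 ⟨x, h e.1 x.2⟩⟩

/-- `θ` witnesses the answer `a` of the dissociated query in the world of all tuples. -/
def IsMatch (q : CQ ι V U) (Δ : ι → Finset V) (D : PDB q.arity U) (a θ : V → U) : Prop :=
  (∀ x ∈ q.head, θ x = a x) ∧ ∀ i, q.groundTuple Δ θ i ∈ q.dissTuples Δ D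

/-- The query event, restricted to valuations into the database. -/
def MatchesIn (q : CQ ι V U) (Δ : ι → Finset V) (D : PDB q.arity U) (a : V → U)
    (W : Finset (q.DissTuple Δ)) : Prop :=
  ∃ θ, q.IsMatch Δ D a θ ∧ ∀ i, q.groundTuple Δ θ i ∈ W

lemma restrictTuple_mem (h : Δ ≤ Δ') {e : q.DissTuple Δ'} (he : e ∈ q.dissTuples Δ' D) :
    q.restrictTuple h e ∈ q.dissTuples Δ D := by
  simp only [dissTuples, Finset.mem_sigma, Finset.mem_product, Fintype.mem_piFinset] at he ⊢
  exact ⟨he.1, he.2.1, fun x => he.2.2 _⟩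

/-- Restricting to matches is void on worlds of the database, but it makes the event depend, in
arbitrary worlds, only on tuples used by some match. -/
lemma reliability_eq_matchesIn (a : V → U) :
    q.reliability Δ D a =
      worldProb (q.dissTuples Δ D) (q.tupleProb Δ D) (q.MatchesIn Δ D a) := by
  rw [reliability_eq_worldProb]
  refine worldProb_congr fun W hW => exists_congr fun θ => ?_
  constructor
  · exact fun h => ⟨⟨h.1, fun i => hW (h.2 i)⟩, h.2⟩
  · exact fun h => ⟨h.1.1, h.2⟩

/-- Puts both reliabilities on one event: that of `Δ'`, with all copies of a tuple present or absent
together. Added variables occur in the query, so their values lie in the active domain. -/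
lemma reliability_eq_restrict (h : Δ ≤ Δ') (hΔ' : ∀ i, Δ' i ⊆ q.vars) (a : V → U) :
    q.reliability Δ D a = worldProb (q.dissTuples Δ D) (q.tupleProb Δ D) fun W =>
      q.MatchesIn Δ' D a (copiesOf (q.restrictTuple h) (q.dissTuples Δ' D) W) := by
  rw [reliability_eq_worldProb]
  refine worldProb_congr fun W hW => exists_congr fun θ => ?_
  constructor
  · rintro ⟨h1, h2⟩
    have hm : ∀ i, q.groundTuple Δ' θ i ∈ q.dissTuples Δ' D := fun i => by
      refine groundTuple_mem_dissTuples.2 ⟨(groundTuple_mem_dissTuples.1 (hW (h2 i))).1, ?_⟩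
      intro x hx
      obtain ⟨j, hj⟩ := mem_vars.1 (hΔ' i hx)
      exact mem_activeDomain_of_ground (groundTuple_mem_dissTuples.1 (hW (h2 j))).1 hj
    exact ⟨⟨h1, hm⟩, fun i => mem_copiesOf.2 ⟨hm i, h2 i⟩⟩
  · exact fun hm => ⟨hm.1.1, fun i => (mem_copiesOf.1 (hm.2 i)).2⟩

/-- Dissociation does not decrease the reliability. -/
theorem reliability_mono (h : Δ ≤ Δ') (hΔ' : ∀ i, Δ' i ⊆ q.vars) (a : V → U) :
    q.reliability Δ D a ≤ q.reliability Δ' D a := by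
  rw [reliability_eq_restrict h hΔ', reliability_eq_matchesIn]
  refine worldProb_le_copies (p := q.tupleProb Δ D) (f := q.restrictTuple h)
    (fun e he => restrictTuple_mem h he)
    (fun e he => D.prob_nonneg _ _ (fst_mem_of_mem_dissTuples he))
    (fun e he => D.prob_le_one _ _ (fst_mem_of_mem_dissTuples he)) ?_ ?_
  · rintro W W' hW ⟨θ, h1, h2⟩
    exact ⟨θ, h1, fun i => hW (h2 i)⟩
  · rintro W ⟨θ, h1, h2⟩
    -- The image of one valuation has one tuple per relation. As there are no self-joins, it cannot
    -- contain two copies of the same tuple.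
    refine ⟨Finset.univ.image (q.groundTuple Δ' θ), ?_, ⟨θ, h1, fun i => by simp⟩, ?_⟩
    · intro e he
      obtain ⟨i, -, rfl⟩ := Finset.mem_image.1 he
      exact h2 i
    · intro e he e' he' hee
      simp only [Finset.coe_image, Finset.coe_univ, Set.image_univ, Set.mem_range] at he he'
      obtain ⟨i, rfl⟩ := he
      obtain ⟨j, rfl⟩ := he'
      obtain rfl : i = j := congrArg Sigma.fst hee
      rfl

/-- The reliability is unchanged if deterministic relations are dissociated, or relations on
variables whose values are determined in all matches. -/
theorem reliability_eq_of_determined (h : Δ ≤ Δ') (hΔ' : ∀ i, Δ' i ⊆ q.vars) (a : V → U)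
    (hdet : ∀ i, (∀ t ∈ D.tuples i, D.prob i t = 1) ∨
      ∀ θ θ', q.IsMatch Δ' D a θ → q.IsMatch Δ' D a θ' →
        (∀ x ∈ q.dissVars Δ i, θ x = θ' x) → ∀ x ∈ Δ' i, θ x = θ' x) :
    q.reliability Δ D a = q.reliability Δ' D a := by
  rw [reliability_eq_restrict h hΔ', reliability_eq_matchesIn]
  refine worldProb_eq_copies (p := q.tupleProb Δ D) (f := q.restrictTuple h)
    (fun e he => restrictTuple_mem h he) fun t ht => ?_
  refine (hdet t.1).imp (fun hp => hp _ (fst_mem_of_mem_dissTuples ht)) fun hd => ?_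
  -- The copies of `t` used by some match: there is at most one, because the values of the added
  -- variables are determined.
  refine ⟨{e | q.restrictTuple h e = t ∧ ∃ i θ, q.IsMatch Δ' D a θ ∧ q.groundTuple Δ' θ i = e},
    ?_, ?_⟩
  · rintro _ ⟨he, i, θ, hθ, rfl⟩ _ ⟨he', j, θ', hθ', rfl⟩
    have hee : q.groundTuple Δ θ i = q.groundTuple Δ θ' j := he.trans he'.symm
    have hi : i = t.1 := congrArg Sigma.fst he
    obtain ⟨rfl, hθθ⟩ := groundTuple_eq_iff.1 hee
    refine groundTuple_eq_iff.2 ⟨rfl, fun x hx => ?_⟩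
    rcases Finset.mem_union.1 hx with hx | hx
    · exact hθθ x (Finset.mem_union_left _ hx)
    · subst hi
      exact hd θ θ' hθ hθ' hθθ x hx
  · intro W W' hW
    refine exists_congr fun θ => and_congr_right fun hθ => forall_congr' fun i => hW _ ?_
    exact fun he => ⟨he, i, θ, hθ, rfl⟩

/-! ### The extensional score of an enumerated plan -/

open PlanEnum

/-- The event that the subquery with subgoals `S` and existential variables `Y` holds, where `θ`
prescribes the values of all other variables. -/
def SubqueryHolds (q : CQ ι V U) (Δ : ι → Finset V) (Y : Finset V) (S : Finset ι) (θ : V → U)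
    (W : Finset (q.DissTuple Δ)) : Prop :=
  ∃ θ' : V → U, (∀ x ∉ Y, θ' x = θ x) ∧ ∀ i ∈ S, q.groundTuple Δ θ' i ∈ W

/-- Overwrite the values of a valuation on `Y`. -/
noncomputable def overwrite (Y : Finset V) (θ : V → U) (b : {x // x ∈ Y} → U) : V → U :=
  fun x => if h : x ∈ Y then b ⟨x, h⟩ else θ x

lemma overwrite_of_mem {Y : Finset V} {θ : V → U} {b : {x // x ∈ Y} → U} {x : V} (hx : x ∈ Y) :
    overwrite Y θ b x = b ⟨x, hx⟩ := dif_pos hx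

lemma overwrite_of_notMem {Y : Finset V} {θ : V → U} {b : {x // x ∈ Y} → U} {x : V} (hx : x ∉ Y) :
    overwrite Y θ b x = θ x := dif_neg hx

/-- Since `Y` occurs in all subgoals, different values of `Y` use disjoint sets of tuples and give
independent events. A subgoal is needed to force these values into the active domain. -/
lemma worldProb_subqueryHolds_project {S : Finset ι} (hS : S.Nonempty) {X Y : Finset V}
    (hYX : Y ⊆ X) (hY : ∀ i ∈ S, Y ⊆ q.dissVars Δ i) (θ : V → U) :
    worldProb (q.dissTuples Δ D) (q.tupleProb Δ D) (q.SubqueryHolds Δ X S θ) =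
      1 - ∏ b ∈ Fintype.piFinset (fun _ : {x // x ∈ Y} => D.activeDomain),
        (1 - worldProb (q.dissTuples Δ D) (q.tupleProb Δ D)
          (q.SubqueryHolds Δ (X \ Y) S (overwrite Y θ b))) := by
  refine Eq.trans ?_ (worldProb_exists _
    (A := fun b => q.SubqueryHolds Δ (X \ Y) S (overwrite Y θ b))
    (F := fun b => {e | ∃ i ∈ S, ∃ θ' : V → U, (∀ x : {x // x ∈ Y}, θ' x = b x) ∧
      q.groundTuple Δ θ' i = e}) ?_ ?_)
  · refine worldProb_congr fun W hW => ?_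
    constructor
    · rintro ⟨θ', h1, h2⟩
      refine ⟨fun x => θ' x, Fintype.mem_piFinset.2 fun x => ?_, θ', fun x hx => ?_, h2⟩
      · obtain ⟨i, hi⟩ := hS
        exact mem_activeDomain_of_mem_dissTuples (hW (h2 i hi)) (hY i hi x.2)
      · by_cases hxY : x ∈ Y
        · rw [overwrite_of_mem hxY]
        · rw [overwrite_of_notMem hxY]
          exact h1 x fun hxX => hx (Finset.mem_sdiff.2 ⟨hxX, hxY⟩)
    · rintro ⟨b, -, θ', h1, h2⟩
      refine ⟨θ', fun x hx => ?_, h2⟩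
      have hxY : x ∉ Y := fun h => hx (hYX h)
      rw [h1 x fun h => hx (Finset.mem_sdiff.1 h).1, overwrite_of_notMem hxY]
  · intro b _ W W' hW
    refine exists_congr fun θ' => and_congr_right fun hθ' => forall₂_congr fun i hi => hW _ ?_
    refine ⟨i, hi, θ', fun x => ?_, rfl⟩
    rw [hθ' _ fun h => (Finset.mem_sdiff.1 h).2 x.2, overwrite_of_mem x.2]
  · intro b _ b' _ hne
    refine Set.disjoint_left.2 ?_
    rintro _ ⟨i, hi, θ', h1, rfl⟩ ⟨j, -, θ'', h2, he⟩
    refine hne (funext fun x => ?_)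
    rw [← h1, ← h2]
    obtain ⟨rfl, h⟩ := groundTuple_eq_iff.1 he
    exact (h x (hY _ hi x.2)).symm

/-- The parts use different relations, hence are independent; they share no existential variables,
so valuations of the parts can be glued. -/
lemma worldProb_subqueryHolds_join {κ : Type*} [Fintype κ] {S : Finset ι} {X : Finset V}
    (c : κ → Finset ι) (Y : κ → Finset V) (hS : ∀ i, i ∈ S ↔ ∃ k, i ∈ c k)
    (hc : ∀ k l, k ≠ l → Disjoint (c k) (c l)) (hY : ∀ k l, k ≠ l → Disjoint (Y k) (Y l))
    (hYX : ∀ k, Y k ⊆ X) (hloc : ∀ k, ∀ i ∈ c k, ∀ x ∈ q.dissVars Δ i, x ∈ X → x ∈ Y k)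
    (θ : V → U) :
    worldProb (q.dissTuples Δ D) (q.tupleProb Δ D) (q.SubqueryHolds Δ X S θ) =
      ∏ k, worldProb (q.dissTuples Δ D) (q.tupleProb Δ D) (q.SubqueryHolds Δ (Y k) (c k) θ) := by
  refine Eq.trans ?_ (worldProb_forall Finset.univ (A := fun k => q.SubqueryHolds Δ (Y k) (c k) θ)
    (F := fun k => {e | e.1 ∈ c k}) ?_ ?_)
  · refine worldProb_congr fun W hW => ?_
    simp only [Finset.mem_univ, true_imp_iff]
    constructor
    · rintro ⟨θ', h1, h2⟩ k
      refine ⟨fun x => if x ∈ Y k then θ' x else θ x, fun x hx => if_neg hx, fun i hi => ?_⟩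
      convert h2 i ((hS i).2 ⟨k, hi⟩) using 1
      refine groundTuple_eq_iff.2 ⟨rfl, fun x hx => ?_⟩
      by_cases hxY : x ∈ Y k
      · simp [hxY]
      · simp only [hxY, if_false]
        exact (h1 x fun hxX => hxY (hloc k i hi x hx hxX)).symm
    · intro h
      choose θ' h1 h2 using h
      refine ⟨fun x => if h : ∃ k, x ∈ Y k then θ' h.choose x else θ x, fun x hx => ?_,
        fun i hi => ?_⟩
      · exact dif_neg fun ⟨k, hk⟩ => hx (hYX k hk)
      · obtain ⟨k, hk⟩ := (hS i).1 hi
        convert h2 k i hk using 1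
        refine groundTuple_eq_iff.2 ⟨rfl, fun x hx => ?_⟩
        by_cases hex : ∃ l, x ∈ Y l
        · have hxk : x ∈ Y k := hloc k i hk x hx (hYX _ hex.choose_spec)
          have : hex.choose = k := by
            by_contra hne
            exact Finset.disjoint_left.1 (hY _ _ hne) hex.choose_spec hxk
          simp only [dif_pos hex, this]
        · simp only [dif_neg hex]
          exact (h1 k x fun hxk => hex ⟨k, hxk⟩).symm
  · intro k _ W W' hW
    exact exists_congr fun θ' => and_congr_right fun hθ' => forall₂_congr fun i hi => hW _ hi
  · intro k _ l _ hne
    exact Set.disjoint_left.2 fun e h1 h2 => Finset.disjoint_left.1 (hc k l hne) h1 h2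

lemma score_proj (X : Finset V) (P : Plan ι V) (θ : V → U) :
    (Plan.proj X P).score q Δ₀ D θ =
      1 - ∏ b ∈ Fintype.piFinset
            (fun _ : {x // x ∈ P.headVars (q.dissVars Δ₀) \ X} => D.activeDomain),
          (1 - P.score q Δ₀ D (overwrite (P.headVars (q.dissVars Δ₀) \ X) θ b)) := rfl

/-- The atom of the plan tests only the variables of `Δ₀`. `hA` supplies the domain condition for
those that `Δ` adds beyond it. -/
lemma score_atom {i : ι} {θ : V → U} (hΔ : Δ₀ ≤ Δ)
    (hA : ∀ x ∈ Δ i, x ∉ q.dissVars Δ₀ i → θ x ∈ D.activeDomain) :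
    (Plan.atom i).score q Δ₀ D θ =
      worldProb (q.dissTuples Δ D) (q.tupleProb Δ D) (q.SubqueryHolds Δ ∅ {i} θ) := by
  have : worldProb (q.dissTuples Δ D) (q.tupleProb Δ D) (q.SubqueryHolds Δ ∅ {i} θ) =
      worldProb (q.dissTuples Δ D) (q.tupleProb Δ D) fun W => q.groundTuple Δ θ i ∈ W := by
    refine worldProb_congr fun W _ => ?_
    constructor
    · rintro ⟨θ', h1, h2⟩
      obtain rfl : θ' = θ := funext fun x => h1 x (Finset.notMem_empty x)
      exact h2 i (Finset.mem_singleton_self i)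
    · exact fun h => ⟨θ, fun _ _ => rfl, fun j hj => by rwa [Finset.mem_singleton.1 hj]⟩
  rw [this, worldProb_mem, Plan.score]
  have hiff : (q.ground θ i ∈ D.tuples i ∧ ∀ x ∈ Δ₀ i, θ x ∈ D.activeDomain) ↔
      q.groundTuple Δ θ i ∈ q.dissTuples Δ D := by
    rw [groundTuple_mem_dissTuples]
    refine and_congr_right fun hg => ⟨fun h x hx => ?_, fun h x hx => h x (hΔ i hx)⟩
    by_cases hx0 : x ∈ q.dissVars Δ₀ i
    · rcases Finset.mem_union.1 hx0 with hx0 | hx0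
      exacts [mem_activeDomain_of_ground hg hx0, h x hx0]
    · exact hA x hx hx0
  by_cases h : q.groundTuple Δ θ i ∈ q.dissTuples Δ D
  · rw [if_pos h, if_pos (hiff.2 h)]
    rfl
  · rw [if_neg h, if_neg fun h' => h (hiff.1 h')]

/-- The extensional score of an enumerated plan is the probability of the subquery in the
dissociated database. -/
theorem score_eq_worldProb {det S : Finset ι} {H H₀ : Finset V} {P : Plan ι V}
    (hP : Enumerated (q.dissVars Δ₀) det S H P) (hΔ : Δ₀ ≤ Δ)
    (h₀ : varsOf (q.dissVars Δ₀) S ∩ H₀ ⊆ H)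
    (hsub : ∀ i ∈ S, P.dissociation (q.dissVars Δ₀) H₀ i ⊆ Δ i)
    (hloc : ∀ i ∈ S, ∀ x ∈ q.dissVars Δ i, x ∈ varsOf (q.dissVars Δ₀) S \ H →
      x ∈ q.dissVars Δ₀ i ∪ P.dissociation (q.dissVars Δ₀) H₀ i)
    {θ : V → U} (hA : ∀ i ∈ S, ∀ x ∈ Δ i, x ∉ q.dissVars Δ₀ i →
      x ∉ varsOf (q.dissVars Δ₀) S \ H → θ x ∈ D.activeDomain) :
    P.score q Δ₀ D θ = worldProb (q.dissTuples Δ D) (q.tupleProb Δ D)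
      (q.SubqueryHolds Δ (varsOf (q.dissVars Δ₀) S \ H) S θ) := by
  -- `Δ` stays fixed while the induction descends into subplans. By `hloc` a subplan accounts for
  -- all of `Δ` on its own existential variables; by `hA` the other added variables already have
  -- values in the active domain.
  have hΔv : ∀ i, q.dissVars Δ₀ i ⊆ q.dissVars Δ i := fun i =>
    Finset.union_subset_union subset_rfl (hΔ i)
  induction hP generalizing θ with
  | single i H hH =>
    have hv : varsOf (q.dissVars Δ₀) {i} = q.dissVars Δ₀ i := by simp [varsOf]
    rw [hv]
    rw [worldProb_subqueryHolds_project (Finset.singleton_nonempty i) subset_rfl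
      (fun j hj => by
        rw [Finset.mem_singleton.1 hj]
        exact Finset.sdiff_subset.trans (hΔv i))]
    rw [score_proj]
    refine congrArg (1 - ·) (Finset.prod_congr rfl fun b hb => ?_)
    rw [Finset.sdiff_self, score_atom hΔ]
    · rfl
    · intro x hx hx0
      have hxn : x ∉ q.dissVars Δ₀ i \ H := fun h => hx0 (Finset.mem_sdiff.1 h).1
      have := hA i (Finset.mem_singleton_self i) x hx hx0 (by rwa [hv])
      exact (overwrite_of_notMem hxn).symm ▸ this
  | join S H hH hc P hP ih =>
    rw [Plan.score, worldProb_subqueryHolds_join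
      (κ := {c // c ∈ components (q.dissVars Δ₀) S H}) (fun c => c.1)
      (fun c => varsOf (q.dissVars Δ₀) c.1 \ (H ∩ varsOf (q.dissVars Δ₀) c.1))]
    · refine Finset.prod_congr rfl fun c _ => ih c ?_ ?_ ?_ ?_
      · intro x hx
        simp only [Finset.mem_inter] at hx ⊢
        exact ⟨h₀ (Finset.mem_inter.2
          ⟨varsOf_mono (subset_of_mem_components c.2) hx.1, hx.2⟩), hx.1⟩
      · intro i hi x hx
        refine hsub i (subset_of_mem_components c.2 hi) ?_
        rw [Enumerated.dissociation_components hH hP c hi]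
        exact Finset.mem_union_right _ hx
      · intro i hi x hx hxc
        have := hloc i (subset_of_mem_components c.2 hi) x hx (component_sdiff_subset c.2 hxc)
        rw [Enumerated.dissociation_components hH hP c hi] at this
        simp only [Finset.mem_sdiff, Finset.mem_union, Finset.mem_inter] at this hxc ⊢
        tauto
      · intro i hi x hx hx0 hxc
        refine hA i (subset_of_mem_components c.2 hi) x hx hx0 fun hxS => ?_
        have := hloc i (subset_of_mem_components c.2 hi) x (Finset.mem_union_right _ hx) hxS
        rw [Enumerated.dissociation_components hH hP c hi] at this
        have h2 := @Enumerated.dissociation_subset ι V _ det _ _ H₀ (P c) (hP c) i hi x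
        simp only [Finset.mem_sdiff, Finset.mem_union, Finset.mem_inter] at this hxc hxS h2
        tauto
    · intro i
      constructor
      · intro hi
        obtain ⟨c, hcc, hic⟩ := exists_mem_components (vars := q.dissVars Δ₀) (H := H) hi
        exact ⟨⟨c, hcc⟩, hic⟩
      · rintro ⟨c, hic⟩
        exact subset_of_mem_components c.2 hic
    · exact fun c d hne => disjoint_components c.2 d.2 fun h => hne (Subtype.ext h)
    · intro c d hne
      refine Finset.disjoint_left.2 fun x hxc hxd => hne (Subtype.ext ?_)
      exact components_eq_of_mem_varsOf c.2 d.2 (Finset.mem_sdiff.1 hxc).1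
        (Finset.mem_sdiff.1 hxd).1 (Finset.mem_sdiff.1 (component_sdiff_subset c.2 hxc)).2
    · exact fun c => component_sdiff_subset c.2
    · intro c i hi x hx hxS
      have := hloc i (subset_of_mem_components c.2 hi) x hx hxS
      rw [Enumerated.dissociation_components hH hP c hi] at this
      have h2 := @Enumerated.dissociation_subset ι V _ det _ _ H₀ (P c) (hP c) i hi x
      have h3 : x ∈ q.dissVars Δ₀ i → x ∈ varsOf (q.dissVars Δ₀) c.1 :=
        fun h => mem_varsOf.2 ⟨i, hi, h⟩
      simp only [Finset.mem_sdiff, Finset.mem_union, Finset.mem_inter] at this hxS h2 ⊢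
      tauto
  | proj S H w hH h1 hc hw P hP ih =>
    have hwS := (mem_cuts.1 hw).1
    have hwH : P.headVars (q.dissVars Δ₀) \ H = w := by
      rw [hP.headVars_eq, Finset.union_sdiff_cancel_left]
      exact Finset.disjoint_right.2 fun x hx => (Finset.mem_sdiff.1 (hwS hx)).2
    have hSn : S.Nonempty := Finset.card_pos.1 (by omega)
    rw [score_proj, hwH, worldProb_subqueryHolds_project hSn hwS]
    · refine congrArg (1 - ·) (Finset.prod_congr rfl fun b hb => ?_)
      rw [ih (h₀.trans Finset.subset_union_left) hsub, sdiff_sdiff_left, Finset.sup_eq_union]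
      · exact fun i hi x hx hxS => hloc i hi x hx (union_cut_sdiff_subset S hxS)
      · intro i hi x hx hx0 hxn
        -- A variable that has just left the existential ones takes its value from the projection,
        -- which ranges over the active domain.
        by_cases hxw : x ∈ w
        · rw [overwrite_of_mem hxw]
          exact Fintype.mem_piFinset.1 hb _
        · rw [overwrite_of_notMem hxw]
          refine hA i hi x hx hx0 fun h => hxn ?_
          simp only [Finset.mem_sdiff, Finset.mem_union] at h ⊢
          tauto
    · intro i hi
      refine (Enumerated.cut_subset_dissociation h₀ hw hP hi).trans (Finset.union_subset (hΔv i) ?_)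
      exact (hsub i hi).trans Finset.subset_union_right

end CQ

/-! ### From subqueries to the full query -/

namespace CQ

variable {ι V U : Type*} [Fintype ι] {q : CQ ι V U} {Δ Δ' Δ₀ : ι → Finset V} {D : PDB q.arity U}
  {det : Finset ι} {Γs : Set (FD ι V)}

open PlanEnum

lemma isSafe_iff_safeOn :
    q.IsSafe Δ ↔ SafeOn q.atomVars Finset.univ q.head (q.dissVars Δ) := by
  simp only [IsSafe, SafeOn, Set.disjoint_left, Set.ofPred_subset_ofPred, Set.mem_ofPred_eq,
    Finset.mem_univ, true_imp_iff]
  rfl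

lemma dissVars_subset_vars (h : ∀ i, Δ i ⊆ q.vars) (i : ι) : q.dissVars Δ i ⊆ q.vars :=
  Finset.union_subset (atomVars_subset_vars i) (h i)

lemma varsOf_atomVars : varsOf q.atomVars Finset.univ = q.vars := rfl

lemma varsOf_dissVars (h : ∀ i, Δ i ⊆ q.vars) : varsOf (q.dissVars Δ) Finset.univ = q.vars := by
  refine subset_antisymm (Finset.biUnion_subset.2 fun i _ => dissVars_subset_vars h i) ?_
  exact Finset.biUnion_mono fun i _ => Finset.subset_union_left

/-- The query event of `q^Δ`, as the event of the subquery consisting of all subgoals. -/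
lemma reliability_eq_subqueryHolds (h : ∀ i, Δ i ⊆ q.vars) (a : V → U) :
    q.reliability Δ D a = worldProb (q.dissTuples Δ D) (q.tupleProb Δ D)
      (q.SubqueryHolds Δ (q.vars \ q.head) Finset.univ a) := by
  rw [reliability_eq_worldProb]
  refine worldProb_congr fun W _ => ?_
  constructor
  · rintro ⟨θ, h1, h2⟩
    refine ⟨fun x => if x ∈ q.vars \ q.head then θ x else a x, fun x hx => if_neg hx,
      fun i _ => ?_⟩
    convert h2 i using 1
    refine groundTuple_eq_iff.2 ⟨rfl, fun x hx => ?_⟩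
    by_cases hxH : x ∈ q.head
    · simp [hxH, h1 x hxH]
    · simp [hxH, dissVars_subset_vars h i hx]
  · rintro ⟨θ, h1, h2⟩
    exact ⟨θ, fun x hx => h1 x fun h => (Finset.mem_sdiff.1 h).2 hx, fun i =>
      h2 i (Finset.mem_univ i)⟩

lemma isDissociation_of_enumerated {P : Plan ι V} (h0 : ∀ i, Δ₀ i ⊆ q.vars)
    (hP : Enumerated (q.dissVars Δ₀) det Finset.univ q.head P) :
    q.IsDissociation Δ₀ (P.dissociation (q.dissVars Δ₀) q.head) := fun i => by
  have := hP.dissociation_subset (H₀ := q.head) (Finset.mem_univ i)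
  rwa [varsOf_dissVars h0] at this

lemma sup_dissociation_subset_vars {P : Plan ι V} (h0 : ∀ i, Δ₀ i ⊆ q.vars)
    (hP : Enumerated (q.dissVars Δ₀) det Finset.univ q.head P) (i : ι) :
    (Δ₀ ⊔ P.dissociation (q.dissVars Δ₀) q.head) i ⊆ q.vars :=
  Finset.union_subset (h0 i)
    ((isDissociation_of_enumerated h0 hP i).trans Finset.sdiff_subset)

lemma isSafe_of_enumerated {P : Plan ι V} (h0 : ∀ i, Δ₀ i ⊆ q.vars)
    (hP : Enumerated (q.dissVars Δ₀) det Finset.univ q.head P) :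
    q.IsSafe (Δ₀ ⊔ P.dissociation (q.dissVars Δ₀) q.head) := by
  have := hP.safeOn_dissociation (H₀ := q.head) Finset.inter_subset_right
  rw [isSafe_iff_safeOn]
  intro x hx y hy
  rw [varsOf_atomVars, ← varsOf_dissVars h0] at hx hy
  simpa only [dissVars, Pi.sup_apply, Finset.sup_eq_union, Finset.union_assoc] using this x hx y hy

lemma score_eq_reliability {P : Plan ι V} (h0 : ∀ i, Δ₀ i ⊆ q.vars)
    (hP : Enumerated (q.dissVars Δ₀) det Finset.univ q.head P)
    (D : PDB q.arity U) (a : V → U) :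
    P.score q Δ₀ D a = q.reliability (Δ₀ ⊔ P.dissociation (q.dissVars Δ₀) q.head) D a := by
  rw [reliability_eq_subqueryHolds (sup_dissociation_subset_vars h0 hP), ← varsOf_dissVars h0]
  -- The domain condition is vacuous here: a plan adds only existential variables.
  refine score_eq_worldProb (H₀ := q.head) hP le_sup_left Finset.inter_subset_right
    (fun i _ => Finset.subset_union_right) (fun i _ x hx _ => ?_) fun i hi x hx hx0 hxn => ?_
  · simpa only [dissVars, Pi.sup_apply, Finset.sup_eq_union, Finset.union_assoc] using hx
  · rcases Finset.mem_union.1 hx with hx | hx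
    · exact absurd (Finset.mem_union_right _ hx) hx0
    · refine absurd (Finset.mem_sdiff.2 ⟨?_, ?_⟩) hxn
      · exact (Finset.mem_sdiff.1 (hP.dissociation_subset hi hx)).1
      · exact Finset.disjoint_left.1 (hP.dissociation_disjoint hi) hx

lemma isPlanFor_of_enumerated {P : Plan ι V}
    (hP : Enumerated (q.dissVars Δ₀) det Finset.univ q.head P) :
    P.IsPlanFor (q.dissVars Δ₀) q.head :=
  ⟨hP.atoms_eq, hP.headVars_eq, hP.wellFormed, fun x =>
    (hP.projCount_le x).trans (by split_ifs <;> norm_num)⟩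

lemma reliability_eq_of_det (h : Δ ≤ Δ') (hΔ' : ∀ i, Δ' i ⊆ q.vars)
    (hdet : ∀ i, i ∉ det → Δ' i ⊆ Δ i) (hD : q.Conforms det Γs D) (a : V → U) :
    q.reliability Δ D a = q.reliability Δ' D a := by
  refine reliability_eq_of_determined h hΔ' a fun i => ?_
  by_cases hi : i ∈ det
  · exact .inl (hD.1 i hi)
  · exact .inr fun θ θ' _ _ heq x hx => heq x (Finset.mem_union_right _ (hdet i hi hx))

/-! ### Closure under functional dependencies -/

/-- The closure of a set of variables under functional dependencies. -/
inductive FDClosure (Γs : Set (FD ι V)) (X : Finset V) : V → Prop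
  | base (x : V) (hx : x ∈ X) : FDClosure Γs X x
  | step (Γ : FD ι V) (hΓ : Γ ∈ Γs) (h : ∀ x ∈ Γ.lhs, FDClosure Γs X x) (y : V)
      (hy : y ∈ Γ.rhs) : FDClosure Γs X y

/-- Both valuations map every subgoal into the database, so each dependency can be applied to its
own relation, wherever the closure is taken. -/
lemma FDClosure.agree (hD : q.Conforms det Γs D) {θ θ' : V → U}
    (hθ : ∀ i, q.ground θ i ∈ D.tuples i) (hθ' : ∀ i, q.ground θ' i ∈ D.tuples i)
    {X : Finset V} (hX : ∀ x ∈ X, θ x = θ' x) {x : V} (hx : FDClosure Γs X x) : θ x = θ' x := by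
  induction hx with
  | base x hx => exact hX x hx
  | step Γ hΓ _ y hy ih => exact hD.2 Γ hΓ θ θ' (hθ _) (hθ' _) ih y hy

/-- Add `y` to every subgoal that contains the left-hand side `Y` of a dependency `Y → y`. -/
noncomputable def addDependent {ι V : Type*} (Y : Finset V) (y : V) (E : ι → Finset V) :
    ι → Finset V :=
  fun j => if Y ⊆ E j then insert y (E j) else E j

lemma mem_addDependent {ι V : Type*} {Y : Finset V} {y x : V} {E : ι → Finset V} {j : ι} :
    x ∈ addDependent Y y E j ↔ x ∈ E j ∨ x = y ∧ Y ⊆ E j := by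
  unfold addDependent
  split_ifs with h <;> simp [h, or_comm]

/-- Dissociating on a functionally dependent variable preserves safety. -/
lemma safeOn_addDependent {vars : ι → Finset V} {H Y : Finset V} {y : V} {E : ι → Finset V}
    (h : SafeOn vars Finset.univ H E) (hH : ∀ i, H ⊆ E i) (hE : ∀ i, vars i ⊆ E i) {r : ι}
    (hY : Y ⊆ vars r) (hy : y ∈ vars r) : SafeOn vars Finset.univ H (addDependent Y y E) := by
  have hv : ∀ x ∈ vars r, x ∈ varsOf vars Finset.univ := fun x hx =>
    mem_varsOf.2 ⟨r, Finset.mem_univ r, hx⟩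
  by_cases hyH : y ∈ H
  · have : addDependent Y y E = E := by
      funext j
      ext x
      rw [mem_addDependent, or_iff_left_iff_imp]
      rintro ⟨rfl, -⟩
      exact hH j hyH
    rwa [this]
  have hother : ∀ x, x ≠ y → ∀ j, x ∈ addDependent Y y E j ↔ x ∈ E j := fun x hx j => by
    simp [mem_addDependent, hx]
  -- After the addition `y` occurs everywhere or exactly where some existential `u` occurred before,
  -- so no new pattern of occurrences arises.
  have key : (∀ j, y ∈ addDependent Y y E j) ∨
      ∃ u ∈ varsOf vars Finset.univ \ H, ∀ j, y ∈ addDependent Y y E j ↔ u ∈ E j := by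
    rcases (Y \ H).eq_empty_or_nonempty with hem | hne
    · refine .inl fun j => mem_addDependent.2 (.inr ⟨rfl, ?_⟩)
      exact (Finset.sdiff_eq_empty_iff_subset.1 hem).trans (hH j)
    right
    -- The variables of `Y \ H` meet in `r`, so their occurrence sets form a chain. For `m` in the
    -- fewest subgoals, `Y ⊆ E j` therefore means `m ∈ E j`.
    obtain ⟨m, hm, hmin⟩ := Finset.exists_min_image _
      (fun x => (Finset.univ.filter fun i => x ∈ E i).card) hne
    have hm' := Finset.mem_sdiff.1 hm
    have hmv : m ∈ varsOf vars Finset.univ \ H := Finset.mem_sdiff.2 ⟨hv m (hY hm'.1), hm'.2⟩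
    have hlow : ∀ l ∈ Y \ H, ∀ j, m ∈ E j → l ∈ E j := by
      intro l hl
      have hl' := Finset.mem_sdiff.1 hl
      rcases h m hmv l (Finset.mem_sdiff.2 ⟨hv l (hY hl'.1), hl'.2⟩) with h | h | h
      · exact fun j => h j (Finset.mem_univ j)
      · have hsub : (Finset.univ.filter fun i => l ∈ E i) ⊆
            Finset.univ.filter fun i => m ∈ E i := fun j hj =>
          Finset.mem_filter.2 ⟨Finset.mem_univ j,
            h j (Finset.mem_univ j) (Finset.mem_filter.1 hj).2⟩
        have heq := Finset.eq_of_subset_of_card_le hsub (hmin l hl)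
        intro j hj
        have : j ∈ Finset.univ.filter fun i => m ∈ E i := by simp [hj]
        rw [← heq] at this
        exact (Finset.mem_filter.1 this).2
      · exact absurd (hE r (hY hl'.1)) (h r (Finset.mem_univ r) (hE r (hY hm'.1)))
    have hYm : ∀ j, Y ⊆ E j ↔ m ∈ E j := fun j => by
      refine ⟨fun hj => hj hm'.1, fun hj l hl => ?_⟩
      by_cases hlH : l ∈ H
      · exact hH j hlH
      · exact hlow l (Finset.mem_sdiff.2 ⟨hl, hlH⟩) j hj
    have hyv : y ∈ varsOf vars Finset.univ \ H := Finset.mem_sdiff.2 ⟨hv y hy, hyH⟩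
    -- `m` and `y` meet in `r`, hence are nested; the new occurrences of `y` are the larger of the
    -- two sets.
    rcases h m hmv y hyv with h | h | h
    · refine ⟨y, hyv, fun j => ?_⟩
      rw [mem_addDependent, hYm, or_iff_left_iff_imp]
      exact fun hj => h j (Finset.mem_univ j) hj.2
    · refine ⟨m, hmv, fun j => ?_⟩
      rw [mem_addDependent, hYm]
      exact ⟨fun hj => hj.elim (h j (Finset.mem_univ j)) (·.2), fun hj => .inr ⟨rfl, hj⟩⟩
    · exact absurd (hE r hy) (h r (Finset.mem_univ r) (hE r (hY hm'.1)))
  rcases key with hall | ⟨u, hu, hiff⟩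
  · intro a ha b hb
    by_cases hay : a = y
    · exact .inr (.inl fun i _ _ => hay ▸ hall i)
    by_cases hby : b = y
    · exact .inl fun i _ _ => hby ▸ hall i
    · simpa only [hother a hay, hother b hby] using h a ha b hb
  · intro a ha b hb
    by_cases hay : a = y <;> by_cases hby : b = y
    · exact .inl fun i _ hi => (hay.trans hby.symm) ▸ hi
    · simpa only [hay, hiff, hother b hby] using h u hu b hb
    · simpa only [hby, hiff, hother a hay] using h a ha u hu
    · simpa only [hother a hay, hother b hby] using h a ha b hb

/-- Every safe dissociation has a safe extension that is closed under the functional dependencies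
and adds only dependent variables. -/
lemma exists_safeOn_closed (hΓs : ∀ Γ ∈ Γs, q.ValidFD Γ) {E₀ : ι → Finset V}
    (hE₀ : ∀ i, E₀ i ⊆ q.vars) (hH : ∀ i, q.head ⊆ E₀ i) (hv : ∀ i, q.atomVars i ⊆ E₀ i)
    (h : SafeOn q.atomVars Finset.univ q.head E₀) :
    ∃ E : ι → Finset V, (∀ i, E₀ i ⊆ E i) ∧ (∀ i, E i ⊆ q.vars) ∧
      SafeOn q.atomVars Finset.univ q.head E ∧ (∀ i, ∀ x ∈ E i, FDClosure Γs (E₀ i) x) ∧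
      ∀ Γ ∈ Γs, ∀ i, Γ.lhs ⊆ E i → Γ.rhs ⊆ E i := by
  let F : Finset (ι → Finset V) := (Fintype.piFinset fun _ => q.vars.powerset).filter fun E =>
    (∀ i, E₀ i ⊆ E i) ∧ SafeOn q.atomVars Finset.univ q.head E ∧
      ∀ i, ∀ x ∈ E i, FDClosure Γs (E₀ i) x
  have hF : F.Nonempty := ⟨E₀, by
    simpa [F, Fintype.mem_piFinset, h, hE₀] using fun i x hx => FDClosure.base x hx⟩
  -- A largest admissible extension is closed, since any violated dependency would allow
  -- `addDependent` to enlarge it.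
  obtain ⟨E, hEF, hmax⟩ := Finset.exists_max_image F (fun E => ∑ i, (E i).card) hF
  obtain ⟨hEv, hle, hs, hcl⟩ := Finset.mem_filter.1 hEF
  have hEv : ∀ i, E i ⊆ q.vars := fun i => Finset.mem_powerset.1 (Fintype.mem_piFinset.1 hEv i)
  refine ⟨E, hle, hEv, hs, hcl, fun Γ hΓ i hi y hy => ?_⟩
  by_contra hyi
  have hΓv := Finset.union_subset_iff.1 (hΓs Γ hΓ)
  have hsub : ∀ j, E j ⊆ addDependent Γ.lhs y E j := fun j x hx => mem_addDependent.2 (.inl hx)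
  have hmem : addDependent Γ.lhs y E ∈ F := by
    refine Finset.mem_filter.2 ⟨Fintype.mem_piFinset.2 fun j => Finset.mem_powerset.2 ?_,
      fun j => (hle j).trans (hsub j), safeOn_addDependent hs (fun j => (hH j).trans (hle j))
        (fun j => (hv j).trans (hle j)) hΓv.1 (hΓv.2 hy), ?_⟩
    · intro x hx
      rcases mem_addDependent.1 hx with hx | ⟨rfl, -⟩
      exacts [hEv j hx, atomVars_subset_vars _ (hΓv.2 hy)]
    · intro j x hx
      rcases mem_addDependent.1 hx with hx | ⟨rfl, hj⟩
      exacts [hcl j x hx, .step Γ hΓ (fun z hz => hcl j z (hj hz)) _ hy]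
  refine (hmax _ hmem).not_gt (Finset.sum_lt_sum (fun j _ => Finset.card_le_card (hsub j))
    ⟨i, Finset.mem_univ i, Finset.card_lt_card ?_⟩)
  exact (Finset.ssubset_iff_of_subset (hsub i)).2 ⟨y, mem_addDependent.2 (.inr ⟨rfl, hi⟩), hyi⟩

lemma mem_fdStep {p : FD ι V × ι} {i : ι} {x : V} (hx : x ∈ q.fdStep Δ p i) :
    x ∈ Δ i ∨ p.1.lhs ⊆ q.dissVars Δ i ∧ x ∈ p.1.rhs \ q.atomVars i := by
  unfold fdStep at hx
  split_ifs at hx with h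
  · by_cases hi : i = p.2
    · subst hi
      rw [Function.update_self] at hx
      exact (Finset.mem_union.1 hx).imp_right fun hx => ⟨h, hx⟩
    · rw [Function.update_of_ne hi] at hx
      exact .inl hx
  · exact .inl hx

lemma fdDissociation_subset (hΓs : ∀ Γ ∈ Γs, q.ValidFD Γ) {L : List (FD ι V × ι)}
    (hL : ∀ p, p ∈ L ↔ p.1 ∈ Γs) (i : ι) :
    q.fdDissociation L i ⊆ q.vars \ q.atomVars i := by
  refine List.foldlRecOn L q.fdStep (motive := fun Δ => ∀ i, Δ i ⊆ q.vars \ q.atomVars i)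
    (fun i => Finset.empty_subset _) (fun Δ hΔ p hp i x hx => ?_) i
  rcases mem_fdStep hx with hx | ⟨-, hx⟩
  · exact hΔ i hx
  · have hx := Finset.mem_sdiff.1 hx
    exact Finset.mem_sdiff.2 ⟨atomVars_subset_vars _
      (hΓs _ ((hL p).1 hp) (Finset.mem_union_right _ hx.1)), hx.2⟩

/-- The loop may stop short of the closure; completeness needs only that it never exceeds a closed
family. -/
lemma fdDissociation_subset_closed {L : List (FD ι V × ι)} (hL : ∀ p, p ∈ L ↔ p.1 ∈ Γs)
    {E : ι → Finset V} (hv : ∀ i, q.atomVars i ⊆ E i)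
    (hE : ∀ Γ ∈ Γs, ∀ i, Γ.lhs ⊆ E i → Γ.rhs ⊆ E i) (i : ι) : q.fdDissociation L i ⊆ E i := by
  refine List.foldlRecOn L q.fdStep (motive := fun Δ => ∀ i, Δ i ⊆ E i)
    (fun i => Finset.empty_subset _) (fun Δ hΔ p hp i x hx => ?_) i
  rcases mem_fdStep hx with hx | ⟨hl, hx⟩
  · exact hΔ i hx
  · exact hE _ ((hL p).1 hp) i (hl.trans (Finset.union_subset (hv i) (hΔ i)))
      (Finset.mem_sdiff.1 hx).1

/-! ### Correctness of `FP` -/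

/-- Every safe dissociation has at least the reliability of some enumerated plan, provided that
`Δ₀` adds only functionally dependent variables. -/
theorem exists_enumerated_score_le [Nonempty ι] (hΓs : ∀ Γ ∈ Γs, q.ValidFD Γ)
    (h0 : ∀ i, Δ₀ i ⊆ q.vars)
    (hfd₀ : ∀ E : ι → Finset V, (∀ i, q.atomVars i ⊆ E i) →
      (∀ Γ ∈ Γs, ∀ i, Γ.lhs ⊆ E i → Γ.rhs ⊆ E i) → ∀ i, Δ₀ i ⊆ E i)
    (hΔ : ∀ i, Δ i ⊆ q.vars) (hs : q.IsSafe Δ) :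
    ∃ P, Enumerated (q.dissVars Δ₀) det Finset.univ q.head P ∧
      ∀ D : PDB q.arity U, q.Conforms det Γs D → ∀ a : V → U,
        P.score q Δ₀ D a ≤ q.reliability Δ D a := by
  -- Head variables do not affect safety. Adding them everywhere lets dependencies use them on the
  -- left, which is legitimate because the answer fixes their values.
  have hsafe : SafeOn q.atomVars Finset.univ q.head fun i => q.dissVars Δ i ∪ q.head := by
    intro x hx y hy
    have hx' := (Finset.mem_sdiff.1 hx).2
    have hy' := (Finset.mem_sdiff.1 hy).2
    simpa only [Finset.mem_union, hx', hy', or_false] using isSafe_iff_safeOn.1 hs x hx y hy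
  obtain ⟨E, hle, hEv, hEs, hcl, hfd⟩ := exists_safeOn_closed hΓs
    (fun i => Finset.union_subset (dissVars_subset_vars hΔ i) head_subset_vars)
    (fun i => Finset.subset_union_right)
    (fun i => Finset.subset_union_left.trans Finset.subset_union_left) hsafe
  have hEa : ∀ i, q.atomVars i ⊆ E i := fun i =>
    (Finset.subset_union_left.trans Finset.subset_union_left).trans (hle i)
  have hE0 := hfd₀ E hEa hfd
  obtain ⟨P, hP, hPE⟩ := exists_enumerated (vars := q.dissVars Δ₀) (det := det)
    (H := q.head) (H₀ := q.head) (E := E) Finset.univ_nonempty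
    (by rw [varsOf_dissVars h0]; exact head_subset_vars)
    (fun i _ => Finset.union_subset (hEa i) (hE0 i)) (fun i _ => by simp) (hEs.mono subset_rfl (by
      rw [varsOf_dissVars h0, varsOf_atomVars]))
  refine ⟨P, hP, fun D hD a => ?_⟩
  -- `P` is below `E` only on probabilistic relations. Filling up the deterministic ones costs
  -- nothing and puts `P` below everywhere.
  have hEE : E ≤ fun i => if i ∈ det then q.vars else E i := fun i => by
    dsimp only
    split_ifs
    exacts [hEv i, le_rfl]
  have hEv' : ∀ i, (if i ∈ det then q.vars else E i) ⊆ q.vars := fun i => by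
    split_ifs
    exacts [subset_rfl, hEv i]
  have hΔE : Δ ≤ E := fun i =>
    (Finset.subset_union_right.trans Finset.subset_union_left).trans (hle i)
  calc P.score q Δ₀ D a
      = q.reliability (Δ₀ ⊔ P.dissociation (q.dissVars Δ₀) q.head) D a :=
        score_eq_reliability h0 hP D a
    _ ≤ q.reliability (fun i => if i ∈ det then q.vars else E i) D a := by
        refine reliability_mono (fun i => ?_) hEv' a
        by_cases hi : i ∈ det
        · simpa [hi] using sup_dissociation_subset_vars h0 hP i
        · simpa [hi] using Finset.union_subset (hE0 i) (hPE i (Finset.mem_univ i) hi)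
    _ = q.reliability E D a := (reliability_eq_of_det hEE hEv'
        (fun i hi => by simp [hi]) hD a).symm
    _ = q.reliability Δ D a := by
        refine (reliability_eq_of_determined hΔE hEv a fun i =>
          .inr fun θ θ' hθ hθ' heq x hx => ?_).symm
        -- Two matches that agree on the variables of the subgoal also agree on the head, hence on
        -- the closure of both.
        refine FDClosure.agree hD (fun i => (groundTuple_mem_dissTuples.1 (hθ.2 i)).1)
          (fun i => (groundTuple_mem_dissTuples.1 (hθ'.2 i)).1) (fun z hz => ?_) (hcl i x hx)
        rcases Finset.mem_union.1 hz with hz | hz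
        · exact heq z hz
        · rw [hθ.1 z hz, hθ'.1 z hz]

end CQ

/-! ### Assembly of soundness and completeness -/

theorem mainTheorem9 {ι V U : Type*} [Fintype ι] [Nonempty ι]
    (q : CQ ι V U) (det : Finset ι) (Γs : Set (FD ι V)) (hΓs : ∀ Γ ∈ Γs, q.ValidFD Γ)
    -- the order in which the loop visits the pairs of a dependency and a relation
    (L : List (FD ι V × ι)) (hL : ∀ p, p ∈ L ↔ p.1 ∈ Γs)
    -- the dissociation performed by the loop, and the dissociation of a plan for the new query
    (Δ₀ : ι → Finset V) (hΔ₀ : Δ₀ = q.fdDissociation L)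
    (δ : Plan ι V → ι → Finset V) (hδ : δ = Plan.dissociation (q.dissVars Δ₀) q.head) :
    -- every output is a plan for the new query and computes the reliability of its safe dissociation
    (∀ P ∈ q.FP det L,
      P.IsPlanFor (q.dissVars Δ₀) q.head ∧
      q.IsDissociation Δ₀ (δ P) ∧ q.IsSafe (Δ₀ ⊔ δ P) ∧
      ∀ (D : PDB q.arity U) (a : V → U), P.score q Δ₀ D a = q.reliability (Δ₀ ⊔ δ P) D a) ∧
    -- soundness: no output is dominated by another output
    (∀ P ∈ q.FP det L, ∀ P' ∈ q.FP det L, δ P' ≤ δ P → P' = P) ∧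
    -- soundness: no output is strictly dominated by any safe dissociation of the new query
    (∀ P ∈ q.FP det L, ∀ Δ, q.IsDissociation Δ₀ Δ → q.IsSafe (Δ₀ ⊔ Δ) → Δ ≤ δ P →
      (∀ i, i ∉ det → Δ i = δ P i) ∧
      ∀ D : PDB q.arity U, q.Conforms det Γs D → ∀ a : V → U,
        q.reliability (Δ₀ ⊔ Δ) D a = P.score q Δ₀ D a) ∧
    -- completeness: every safe dissociation of the original query is matched by an output
    (∀ Δ, q.IsDissociation ⊥ Δ → q.IsSafe Δ →
      ∃ P ∈ q.FP det L, ∀ D : PDB q.arity U, q.Conforms det Γs D → ∀ a : V → U,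
        P.score q Δ₀ D a ≤ q.reliability Δ D a) ∧
    -- completeness: the minimum score of the outputs is the propagation score
    (∀ D : PDB q.arity U, q.Conforms det Γs D → ∀ a : V → U,
      IsLeast (q.safeReliabilities D a) (q.propagationScore D a) ∧
      IsLeast {s | ∃ P ∈ q.FP det L, s = P.score q Δ₀ D a} (q.propagationScore D a)) := by
  subst hδ
  have h0' : ∀ i, Δ₀ i ⊆ q.vars \ q.atomVars i := fun i =>
    hΔ₀ ▸ CQ.fdDissociation_subset hΓs hL i
  have h0 : ∀ i, Δ₀ i ⊆ q.vars := fun i => (h0' i).trans Finset.sdiff_subset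
  have hFP : ∀ P, P ∈ q.FP det L ↔
      PlanEnum.Enumerated (q.dissVars Δ₀) det Finset.univ q.head P := fun P => by
    rw [CQ.FP, ← hΔ₀]
    refine PlanEnum.mem_DP_iff Finset.univ_nonempty ?_
    rw [CQ.varsOf_dissVars h0]
    exact CQ.head_subset_vars
  have hfd : ∀ E : ι → Finset V, (∀ i, q.atomVars i ⊆ E i) →
      (∀ Γ ∈ Γs, ∀ i, Γ.lhs ⊆ E i → Γ.rhs ⊆ E i) → ∀ i, Δ₀ i ⊆ E i := fun E hE hcl i =>
    hΔ₀ ▸ CQ.fdDissociation_subset_closed hL hE hcl i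
  clear hΔ₀
  -- Both layers together form a dissociation of the original query, so every score is among the
  -- reliabilities that define the propagation score.
  have hsound : ∀ P ∈ q.FP det L,
      q.IsDissociation ⊥ (Δ₀ ⊔ P.dissociation (q.dissVars Δ₀) q.head) := by
    intro P hP i
    have hbot : q.dissVars ⊥ i = q.atomVars i := Finset.union_empty _
    rw [hbot]
    refine Finset.union_subset (h0' i) ?_
    refine (CQ.isDissociation_of_enumerated h0 ((hFP P).1 hP) i).trans ?_
    exact Finset.sdiff_subset_sdiff subset_rfl Finset.subset_union_left
  have hcomplete : ∀ Δ, q.IsDissociation ⊥ Δ → q.IsSafe Δ →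
      ∃ P ∈ q.FP det L, ∀ D : PDB q.arity U, q.Conforms det Γs D → ∀ a : V → U,
        P.score q Δ₀ D a ≤ q.reliability Δ D a := by
    intro Δ hΔ hs
    obtain ⟨P, hP, h⟩ := CQ.exists_enumerated_score_le (det := det) hΓs h0 hfd
      (fun i => (hΔ i).trans Finset.sdiff_subset) hs
    exact ⟨P, (hFP P).2 hP, h⟩
  refine ⟨fun P hP => ?_, fun P hP P' hP' hle => ?_, fun P hP Δ hΔ hs hle => ?_, hcomplete,
    fun D hD a => ?_⟩
  · have hP := (hFP _).1 hP
    exact ⟨CQ.isPlanFor_of_enumerated hP, CQ.isDissociation_of_enumerated h0 hP,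
      CQ.isSafe_of_enumerated h0 hP, CQ.score_eq_reliability h0 hP⟩
  · exact ((hFP _).1 hP).eq_of_dissociation_le ((hFP _).1 hP')
      Finset.inter_subset_right fun i _ => hle i
  · have hP := (hFP _).1 hP
    have hsub : ∀ i, i ∉ det →
        P.dissociation (q.dissVars Δ₀) q.head i ⊆ Δ i := by
      intro i hi
      have hassoc : ∀ i, q.dissVars (Δ₀ ⊔ Δ) i =
          q.dissVars Δ₀ i ∪ Δ i := fun i =>
        (Finset.union_assoc _ _ _).symm
      have := hP.dissociation_subset_of_safe (H₀ := q.head)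
        (E := q.dissVars (Δ₀ ⊔ Δ)) Finset.inter_subset_right
        (fun i _ => (hassoc i).symm ▸ Finset.subset_union_left) (fun i _ => by simp)
        ((CQ.isSafe_iff_safeOn.1 hs).mono subset_rfl (by
          rw [CQ.varsOf_dissVars h0, CQ.varsOf_atomVars]))
        (fun i _ x hx _ => Finset.union_subset_union subset_rfl (hle i) (hassoc i ▸ hx))
        (Finset.mem_univ i) hi
      intro x hx
      rw [hassoc] at this
      refine (Finset.mem_union.1 (this hx)).resolve_left ?_
      exact (Finset.mem_sdiff.1 (CQ.isDissociation_of_enumerated h0 hP i hx)).2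
    refine ⟨fun i hi => subset_antisymm (hle i) (hsub i hi), fun D hD a => ?_⟩
    rw [CQ.score_eq_reliability h0 hP]
    exact CQ.reliability_eq_of_det (sup_le_sup_left hle _)
      (CQ.sup_dissociation_subset_vars h0 hP)
      (fun i hi => Finset.union_subset_union subset_rfl (hsub i hi)) hD a
  · have hmem : ∀ P ∈ q.FP det L, P.score q Δ₀ D a ∈
        q.safeReliabilities D a := fun P hP =>
      ⟨_, hsound P hP, CQ.isSafe_of_enumerated h0 ((hFP _).1 hP),
        CQ.score_eq_reliability h0 ((hFP _).1 hP) D a⟩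
    have hne : (q.FP det L).Nonempty := by
      -- The full dissociation puts every variable into every subgoal and is trivially safe;
      -- completeness applied to it yields an output.
      have hfull : q.IsSafe fun i => q.vars \ q.atomVars i := fun x _ y hy => .inl fun i _ => by
        change y ∈ q.atomVars i ∪ q.vars \ q.atomVars i
        rw [Finset.union_sdiff_of_subset (CQ.atomVars_subset_vars i)]
        exact (Finset.mem_sdiff.1 hy).1
      obtain ⟨P, hP, -⟩ := hcomplete _ (fun i => by simp [CQ.dissVars]) hfull
      exact ⟨P, hP⟩
    obtain ⟨P, hP, hmin⟩ := Finset.exists_min_image (q.FP det L)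
      (fun P => P.score q Δ₀ D a) hne
    have hleast : IsLeast (q.safeReliabilities D a) (P.score q Δ₀ D a) := by
      refine ⟨hmem P hP, ?_⟩
      rintro _ ⟨Δ, hΔ, hs, rfl⟩
      obtain ⟨P', hP', hle⟩ := hcomplete Δ hΔ hs
      exact (hmin P' hP').trans (hle D hD a)
    rw [CQ.propagationScore, hleast.csInf_eq]
    refine ⟨hleast, ⟨P, hP, rfl⟩, ?_⟩
    rintro _ ⟨P', hP', rfl⟩
    exact hmin P' hP'
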